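/- Setting. Identify $\mathbb{R}^2$ with $\mathbb{C}$; a rotation $R_\alpha$ is multiplication by $e^{i\alpha}$. Let the prototiles $P_1,\dots,P_m\subset\mathbb{R}^2$ be compact sets, each equal to the closure of its interior. A tile is a placed copy $T=R_\alpha P_i+t$ with $\alpha\in[0,2\pi)$, $t\in\mathbb{R}^2$, labelled by $(i,\alpha,t)$; its orientation is $\phi(T)=\alpha$. A collection of tiles is non-overlapping if distinct tiles have disjoint interiors, and a tiling is a non-overlapping collection of tiles that covers $\mathbb{R}^2$. Two collections of tiles are congruent (copies of each other) if a map $z\mapsto Rz+s$, with $R$ a rotation and $s \in\mathbb{R}^2$, takes one to the other (respecting labels). A (selfsimilar) substitution $\sigma$ with factor $\lambda>1$ assigns to each $P_i$ a finite non-overlapping collection $\sigma(P_i)$ of tiles with $\lambda P_i=\bigcup_{T\in\sigma(P_i)}T$; it extends to tiles by $\sigma(RP_i+t)=R\,\sigma(P_i)+\lambda t$ and to collections of tiles by taking unions. The collections $\sigma^k(P_i)$ are called supertiles. The substitution is primitive if some power $M^k$, $k\ge 1$, of the matrix $M_{ij}=\#\{T\in\sigma(P_j): T=RP_i+t\}$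 is strictly positive. A tiling $\mathcal{T}$ is a substitution tiling for $\sigma$ if every finite subset of $\mathcal{T}$ has a copy contained in some supertile. It has statistical circular symmetry if its tiles can be numbered, without repetition, as $T_1,T_2,\dots$ such that (a) for every $n$ there is $\ell\ge n$ for which $\{T_1,\dots,T_\ell\}$ is congruent to a supertile $\sigma^k(P_i)$ with $k\ge1$, and (b) for all $0\le x<y<2\pi$, $$\lim_{n\to\infty}\frac1n\sum_{j=1}^n 1_{[x,y]}(\phi(T_j))=\frac{y-x}{2\pi}.$$ Theorem. Let $\mathcal{T}=\{R_{\alpha_1}P_{i_1}+t_1,R_{\alpha_2}P_{i_2}+t_2,\dots\}$ be a substitution tiling for a primitive substitution with prototiles $P_1,\dots,P_m$, and suppose that $\mathcal{T}$ has statistical circular symmetry. Choose control points $x_i\in P_i$ $(1\le i\le m)$ and let $\Lambda=\{R_{\alpha_1}x_{i_1}+t_1,R_{\alpha_2}x_{i_2}+t_2,\dots\}$. Then the autocorrelation $$\gamma_\Lambda=\lim_{r\to\infty}\frac{1}{\operatorname{vol}(B_r)}\sum_{x,y\in\Lambda\cap B_r}\delta_{x-y}$$ ($B_r$ the closed ball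 of radius $r$ about $0$; vague limit, that is, tested against continuous functions of compact support) exists as a locally finite measure, and it is circular symmetric: $R.\gamma_\Lambda=\gamma_\Lambda$ for every rotation $R$ about the origin, where $R.\mu(A)=\mu(R^{-1}A)$. More generally, every locally finite measure that is the vague limit of these normalized sums along some sequence of radii $r_n\to\infty$ is circular symmetric. -/

import Mathlib

open MeasureTheory Filter Topology

noncomputable section

namespace SubstTiling

/-- A (decorated) tile, the Euclidean plane being `ℂ`: `⟨i, u, t⟩` is the copy `u • P i + t` of the
`i`-th prototile, where the unit complex number `u` is a rotation about the origin. Keeping the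
index `i` and the rotation `u` distinguishes congruent prototiles, and makes the orientation
unambiguous for prototiles with a rotational symmetry. -/
@[ext]
structure Tile (m : ℕ) where
  kind : Fin m
  rot : Circle
  trans : ℂ

namespace Tile

variable {m : ℕ}

/-- The subset of the plane occupied by a tile, for prototiles `P`. -/
def support (P : Fin m → Set ℂ) (T : Tile m) : Set ℂ :=
  (fun z : ℂ => (T.rot : ℂ) * z + T.trans) '' P T.kind

/-- The image of a tile under the direct Euclidean motion `z ↦ u z + s`. -/
def move (u : Circle) (s : ℂ) (T : Tile m) : Tile m :=
  ⟨T.kind, u * T.rot, (u : ℂ) * T.trans + s⟩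

/-- The orientation of a tile: the angle `α ∈ [0, 2π)` of its rotation. -/
def orientation (T : Tile m) : ℝ :=
  toIcoMod Real.two_pi_pos 0 (Complex.arg (T.rot : ℂ))

end Tile

/-- No point lies in the interior of two different tiles of the collection. -/
def NonOverlapping {m : ℕ} (P : Fin m → Set ℂ) (A : Set (Tile m)) : Prop :=
  A.Pairwise fun T T' => Disjoint (interior (T.support P)) (interior (T'.support P))

/-- Two collections of tiles are congruent if a direct Euclidean motion maps one to the other. -/
def Congruent {m : ℕ} (A B : Set (Tile m)) : Prop :=
  ∃ (u : Circle) (s : ℂ), A = Tile.move u s '' B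

/-- A selfsimilar tile-substitution in the plane with `m` prototiles. -/
structure Substitution (m : ℕ) where
  /-- the prototiles -/
  proto : Fin m → Set ℂ
  isCompact_proto : ∀ i, IsCompact (proto i)
  closure_interior_proto : ∀ i, closure (interior (proto i)) = proto i
  /-- the inflation factor -/
  factor : ℝ
  one_lt_factor : 1 < factor
  /-- the collection of tiles that replaces the `i`-th prototile -/
  rule : Fin m → Finset (Tile m)
  nonOverlapping_rule : ∀ i, NonOverlapping proto (rule i : Set (Tile m))
  selfsimilar : ∀ i, (fun z : ℂ => (factor : ℂ) * z) '' proto i = ⋃ T ∈ rule i, T.support proto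

namespace Substitution

variable {m : ℕ} (S : Substitution m)

/-- `σ(R P_i + t) = R σ(P_i) + λ t`. -/
def onTile (T : Tile m) : Set (Tile m) :=
  Tile.move T.rot ((S.factor : ℂ) * T.trans) '' (S.rule T.kind : Set (Tile m))

/-- The substitution on finite or infinite collections of tiles. -/
def onPatch (A : Set (Tile m)) : Set (Tile m) :=
  ⋃ T ∈ A, S.onTile T

/-- The supertile `σ^k(P_i)`. -/
def supertile (k : ℕ) (i : Fin m) : Set (Tile m) :=
  S.onPatch^[k] {⟨i, 1, 0⟩}

/-- The substitution matrix: the entry `(i, j)` is the number of tiles of kind `i` in `σ(P_j)`. -/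
def matrix : Matrix (Fin m) (Fin m) ℕ :=
  Matrix.of fun i j => ((S.rule j).filter fun T => T.kind = i).card

def IsPrimitive : Prop :=
  ∃ k : ℕ, 1 ≤ k ∧ ∀ i j, 0 < (S.matrix ^ k) i j

/-- A tiling of the plane by copies of the prototiles. -/
def IsTiling (A : Set (Tile m)) : Prop :=
  (⋃ T ∈ A, T.support S.proto) = Set.univ ∧ NonOverlapping S.proto A

/-- A substitution tiling: a tiling all of whose finite subsets have a copy in a supertile. -/
def IsSubstitutionTiling (A : Set (Tile m)) : Prop :=
  S.IsTiling A ∧ ∀ F : Set (Tile m), F ⊆ A → F.Finite →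
    ∃ (F' : Set (Tile m)) (k : ℕ) (i : Fin m), Congruent F' F ∧ F' ⊆ S.supertile k i

/-- The sequence enumerates the tiles of `A` without repetition, and arbitrarily long initial
segments of it are congruent to supertiles. -/
def IsSupertileNumbering (A : Set (Tile m)) (T : ℕ → Tile m) : Prop :=
  Function.Injective T ∧ Set.range T = A ∧
    ∀ n : ℕ, ∃ ℓ : ℕ, n ≤ ℓ ∧ ∃ (k : ℕ) (i : Fin m), 1 ≤ k ∧
      Congruent (T '' {j | j < ℓ}) (S.supertile k i)

end Substitution

/-- Equidistribution of a sequence in `[0, 2π)`. -/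
def Equidistributed (a : ℕ → ℝ) : Prop :=
  ∀ x y : ℝ, 0 ≤ x → x < y → y < 2 * Real.pi →
    Tendsto (fun n : ℕ => (1 / (n : ℝ)) *
      ∑ j ∈ Finset.range n, (Set.Icc x y).indicator (fun _ => (1 : ℝ)) (a j))
      atTop (𝓝 ((y - x) / (2 * Real.pi)))

/-- Statistical circular symmetry: in a numbering of the tiles along supertiles, the orientations
are equidistributed. -/
def Substitution.HasStatisticalCircularSymmetry {m : ℕ} (S : Substitution m)
    (A : Set (Tile m)) : Prop :=
  ∃ T : ℕ → Tile m, S.IsSupertileNumbering A T ∧ Equidistributed fun j => (T j).orientation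

/-- The set of control points of the tiles in `A`, for control points `x i` of the prototiles. -/
def controlPoints {m : ℕ} (x : Fin m → ℂ) (A : Set (Tile m)) : Set ℂ :=
  (fun T : Tile m => (T.rot : ℂ) * x T.kind + T.trans) '' A

/-- The measure `vol(B_r)⁻¹ ∑_{x, y ∈ Λ ∩ B_r} δ_{x - y}`. -/
def autocorrelationApprox (Λ : Set ℂ) (r : ℝ) : Measure ℂ :=
  (volume (Metric.closedBall (0 : ℂ) r))⁻¹ •
    Measure.sum fun p : ((Λ ∩ Metric.closedBall 0 r) ×ˢ (Λ ∩ Metric.closedBall 0 r) : Set (ℂ × ℂ)) =>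
      Measure.dirac (p.1.1 - p.1.2)

/-- Vague convergence to a locally finite Borel measure of the plane. -/
def VagueTendsto {ι : Type*} (μ : ι → Measure ℂ) (l : Filter ι) (γ : Measure ℂ) : Prop :=
  IsLocallyFiniteMeasure γ ∧ ∀ f : ℂ → ℝ, Continuous f → HasCompactSupport f →
    Tendsto (fun i => ∫ z, f z ∂(μ i)) l (𝓝 (∫ z, f z ∂γ))

/-- `γ` is the autocorrelation of `Λ`, as a vague limit for `r → ∞`. -/
def IsAutocorrelation (Λ : Set ℂ) (γ : Measure ℂ) : Prop :=
  VagueTendsto (autocorrelationApprox Λ) atTop γ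

/-- `γ` is an autocorrelation of `Λ` along some sequence of radii tending to infinity. -/
def IsSubsequentialAutocorrelation (Λ : Set ℂ) (γ : Measure ℂ) : Prop :=
  ∃ r : ℕ → ℝ, Tendsto r atTop atTop ∧
    VagueTendsto (fun n => autocorrelationApprox Λ (r n)) atTop γ

/-- `R.μ = μ` for all rotations `R` about the origin, where `R.μ(A) = μ(R⁻¹ A)`. -/
def IsCircularSymmetric (μ : Measure ℂ) : Prop :=
  ∀ u : Circle, μ.map (rotation u) = μ

end SubstTiling

end

open scoped Pointwise

noncomputable section

namespace SubstTiling

variable {m : ℕ}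

/-- The direct Euclidean motion `z ↦ u z + s`. -/
def motion (u : Circle) (s : ℂ) : ℂ ≃ᵢ ℂ :=
  (rotation u).toIsometryEquiv.trans (IsometryEquiv.addRight s)

theorem motion_apply (u : Circle) (s z : ℂ) : motion u s z = u * z + s := rfl

theorem measurePreserving_motion (u : Circle) (s : ℂ) :
    MeasurePreserving (motion u s) volume volume :=
  (measurePreserving_add_right volume s).comp (rotation u).measurePreserving

theorem volume_motion_image (u : Circle) (s : ℂ) (E : Set ℂ) :
    volume (motion u s '' E) = volume E := by
  have h := (show MeasurePreserving (motion u s).toHomeomorph.toMeasurableEquiv volume volume from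
    measurePreserving_motion u s).measure_preimage_equiv (motion u s '' E)
  rw [← h]
  congr 1
  exact Set.preimage_image_eq E (motion u s).injective

theorem smul_motion (c : ℝ) (u : Circle) (s z : ℂ) :
    c • motion u s z = motion u (c * s) (c • z) := by
  simp only [motion_apply, Complex.real_smul]; ring

theorem interior_motion_image (u : Circle) (s : ℂ) (E : Set ℂ) :
    interior (motion u s '' E) = motion u s '' interior E :=
  ((motion u s).toHomeomorph.image_interior E).symm

instance Tile.instDecidableEq : DecidableEq (Tile m) := Classical.decEq _

namespace Tile

theorem support_eq (P : Fin m → Set ℂ) (T : Tile m) :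
    T.support P = motion T.rot T.trans '' P T.kind := rfl

theorem support_move (P : Fin m → Set ℂ) (u : Circle) (s : ℂ) (T : Tile m) :
    (T.move u s).support P = motion u s '' T.support P := by
  simp only [support, move, Set.image_image, motion_apply, Circle.coe_mul]
  congr 1; ext z; ring

theorem interior_support (P : Fin m → Set ℂ) (T : Tile m) :
    interior (T.support P) = motion T.rot T.trans '' interior (P T.kind) :=
  interior_motion_image _ _ _

theorem move_injective (u : Circle) (s : ℂ) : Function.Injective (move (m := m) u s) := by
  rintro ⟨i, v, t⟩ ⟨i', v', t'⟩ h
  simp only [move, Tile.mk.injEq, mul_right_inj, add_left_inj, mul_eq_mul_left_iff,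
    Circle.coe_ne_zero, or_false] at h
  simp [h]

theorem move_move (u u' : Circle) (s s' : ℂ) (T : Tile m) :
    (T.move u s).move u' s' = T.move (u' * u) (u' * s + s') := by
  simp only [move, Circle.coe_mul, Tile.mk.injEq, mul_assoc, true_and]
  ring

theorem exists_move_eq {T T' : Tile m} (h : T.kind = T'.kind) :
    ∃ s, T' = T.move (T'.rot / T.rot) s := by
  refine ⟨T'.trans - (T'.rot / T.rot : Circle) * T.trans, ?_⟩
  ext <;> simp [move, h]

end Tile

namespace NonOverlapping

variable {P : Fin m → Set ℂ}

theorem mono {A B : Set (Tile m)} (hA : NonOverlapping P A) (h : B ⊆ A) :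
    NonOverlapping P B :=
  Set.Pairwise.mono h hA

theorem move {A : Set (Tile m)} (hA : NonOverlapping P A) (u : Circle) (s : ℂ) :
    NonOverlapping P (Tile.move u s '' A) := by
  rintro _ ⟨T, hT, rfl⟩ _ ⟨T', hT', rfl⟩ hne
  rw [Tile.support_move, Tile.support_move, interior_motion_image, interior_motion_image,
    Set.disjoint_image_iff (motion u s).injective]
  exact hA hT hT' (fun h => hne (h ▸ rfl))

end NonOverlapping

namespace Substitution

variable (S : Substitution m)

theorem factor_pos : 0 < S.factor := zero_lt_one.trans S.one_lt_factor

theorem factor_pow_pos (k : ℕ) : 0 < S.factor ^ k := pow_pos S.factor_pos k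

theorem closure_interior_support (T : Tile m) :
    closure (interior (T.support S.proto)) = T.support S.proto := by
  rw [Tile.interior_support]
  exact ((motion T.rot T.trans).toHomeomorph.image_closure _).symm.trans
    (by rw [S.closure_interior_proto]; rfl)

theorem isCompact_support (T : Tile m) : IsCompact (T.support S.proto) :=
  (S.isCompact_proto _).image (motion T.rot T.trans).continuous

/-- In a non-overlapping collection, the interior of a tile does not meet any other tile. -/
theorem disjoint_interior_support {A : Set (Tile m)} (hA : NonOverlapping S.proto A)
    {T T' : Tile m} (hT : T ∈ A) (hT' : T' ∈ A) (hne : T ≠ T') :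
    Disjoint (interior (T.support S.proto)) (T'.support S.proto) := by
  rw [← S.closure_interior_support T']
  exact (hA hT hT' hne).closure_right isOpen_interior

theorem interior_support_nonempty (hP : ∀ i, (S.proto i).Nonempty) (T : Tile m) :
    (interior (T.support S.proto)).Nonempty := by
  rw [← closure_nonempty_iff, S.closure_interior_support]
  exact (hP _).image _

/-- The tiles that replace a tile under the substitution. -/
def inflate (T : Tile m) : Finset (Tile m) :=
  (S.rule T.kind).image (Tile.move T.rot ((S.factor : ℂ) * T.trans))

theorem coe_inflate (T : Tile m) : (S.inflate T : Set (Tile m)) = S.onTile T := by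
  simp [inflate, onTile]

/-- The collection of tiles that replaces a tile under the `k`-th power of the substitution. -/
def superTile : ℕ → Tile m → Finset (Tile m)
  | 0, T => {T}
  | k + 1, T => (superTile k T).biUnion S.inflate

theorem superTile_zero (T : Tile m) : S.superTile 0 T = {T} := rfl

theorem superTile_succ (k : ℕ) (T : Tile m) :
    S.superTile (k + 1) T = (S.superTile k T).biUnion S.inflate := rfl

theorem coe_superTile (k : ℕ) (T : Tile m) :
    (S.superTile k T : Set (Tile m)) = S.onPatch^[k] {T} := by
  induction k with
  | zero => simp [superTile_zero]
  | succ k ih =>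
    rw [Function.iterate_succ_apply', ← ih, superTile_succ, onPatch]
    simp [coe_inflate]

theorem coe_superTile_proto (k : ℕ) (i : Fin m) :
    (S.superTile k ⟨i, 1, 0⟩ : Set (Tile m)) = S.supertile k i :=
  S.coe_superTile k _

theorem superTile_add (a b : ℕ) (T : Tile m) :
    S.superTile (a + b) T = (S.superTile a T).biUnion (S.superTile b) := by
  induction b with
  | zero => exact Finset.biUnion_singleton_eq_self.symm
  | succ b ih =>
    rw [← add_assoc, superTile_succ, ih, Finset.biUnion_biUnion]
    rfl

theorem inflate_move (u : Circle) (s : ℂ) (T : Tile m) :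
    S.inflate (T.move u s) = (S.inflate T).image (Tile.move u (S.factor * s)) := by
  simp only [inflate, Finset.image_image]
  refine Finset.image_congr fun T' _ => ?_
  simp only [Function.comp, Tile.move_move]
  simp only [Tile.move]
  congr 2; ring

theorem superTile_move (k : ℕ) (u : Circle) (s : ℂ) (T : Tile m) :
    S.superTile k (T.move u s) =
      (S.superTile k T).image (Tile.move u ((S.factor ^ k : ℝ) * s)) := by
  induction k with
  | zero => simp [superTile_zero]
  | succ k ih =>
    rw [superTile_succ, ih, superTile_succ, Finset.biUnion_image, Finset.image_biUnion]
    refine Finset.biUnion_congr rfl fun T' _ => ?_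
    rw [inflate_move]
    congr 2
    push_cast
    ring

theorem biUnion_inflate_support (T : Tile m) :
    ⋃ T' ∈ S.inflate T, T'.support S.proto = S.factor • T.support S.proto := by
  have h : ⋃ T' ∈ S.inflate T, T'.support S.proto =
      motion T.rot (S.factor * T.trans) '' ⋃ T' ∈ S.rule T.kind, T'.support S.proto := by
    simp only [inflate, Finset.mem_image, Set.iUnion_exists, Set.biUnion_and',
      Set.iUnion_iUnion_eq_right, Tile.support_move, Set.image_iUnion]
  rw [h, ← S.selfsimilar, Set.image_image, Tile.support_eq]
  ext z
  simp only [Set.mem_image, Set.mem_smul_set, exists_exists_and_eq_and, smul_motion]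
  simp only [Complex.real_smul]

theorem biUnion_superTile_support (k : ℕ) (T : Tile m) :
    ⋃ T' ∈ S.superTile k T, T'.support S.proto = S.factor ^ k • T.support S.proto := by
  induction k with
  | zero => simp [superTile_zero]
  | succ k ih =>
    rw [superTile_succ, Finset.set_biUnion_biUnion]
    simp only [biUnion_inflate_support]
    rw [pow_succ', mul_smul, ← ih, Set.smul_set_iUnion₂]

theorem support_subset_of_mem_superTile {k : ℕ} {T T' : Tile m} (h : T' ∈ S.superTile k T) :
    T'.support S.proto ⊆ S.factor ^ k • T.support S.proto := by
  rw [← biUnion_superTile_support]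
  exact Set.subset_biUnion_of_mem (u := fun T' : Tile m => T'.support S.proto) h

theorem interior_support_subset_of_mem_superTile {k : ℕ} {T T' : Tile m}
    (h : T' ∈ S.superTile k T) :
    interior (T'.support S.proto) ⊆ S.factor ^ k • interior (T.support S.proto) := by
  rw [← interior_smul₀ (S.factor_pow_pos k).ne']
  exact interior_mono (S.support_subset_of_mem_superTile h)

theorem disjoint_interior_of_mem_superTile {A : Set (Tile m)} (hA : NonOverlapping S.proto A)
    {k : ℕ} {T T' U U' : Tile m} (hT : T ∈ A) (hT' : T' ∈ A) (hne : T ≠ T')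
    (hU : U ∈ S.superTile k T) (hU' : U' ∈ S.superTile k T') :
    Disjoint (interior (U.support S.proto)) (interior (U'.support S.proto)) := by
  refine Disjoint.mono (S.interior_support_subset_of_mem_superTile hU)
    (S.interior_support_subset_of_mem_superTile hU') ?_
  exact (Set.disjoint_image_iff (smul_right_injective ℂ (S.factor_pow_pos k).ne')).2
    (hA hT hT' hne)

theorem nonOverlapping_inflate (T : Tile m) :
    NonOverlapping S.proto (S.inflate T : Set (Tile m)) := by
  rw [coe_inflate]
  exact (S.nonOverlapping_rule T.kind).move _ _

theorem superTile_one (T : Tile m) : S.superTile 1 T = S.inflate T := by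
  simp [superTile]

theorem nonOverlapping_superTile (k : ℕ) (T : Tile m) :
    NonOverlapping S.proto (S.superTile k T : Set (Tile m)) := by
  induction k with
  | zero => simp [superTile_zero, NonOverlapping]
  | succ k ih =>
    intro U hU U' hU' hne
    simp only [superTile_succ, Finset.coe_biUnion, Set.mem_iUnion, Finset.mem_coe] at hU hU'
    obtain ⟨V, hV, hUV⟩ := hU
    obtain ⟨V', hV', hUV'⟩ := hU'
    by_cases h : V = V'
    · subst h
      exact S.nonOverlapping_inflate V hUV hUV' hne
    · rw [← superTile_one] at hUV hUV'
      exact S.disjoint_interior_of_mem_superTile ih hV hV' h hUV hUV'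

theorem pairwiseDisjoint_superTile (hP : ∀ i, (S.proto i).Nonempty) {A : Set (Tile m)}
    (hA : NonOverlapping S.proto A) (k : ℕ) : A.PairwiseDisjoint (S.superTile k) := by
  intro T hT T' hT' hne
  rw [Function.onFun, Finset.disjoint_left]
  intro U hU hU'
  have h := S.disjoint_interior_of_mem_superTile hA hT hT' hne hU hU'
  rw [disjoint_self, Set.bot_eq_empty] at h
  exact (S.interior_support_nonempty hP U).ne_empty h

theorem sum_superTile_add (hP : ∀ i, (S.proto i).Nonempty) (a b : ℕ) (T : Tile m)
    (h : Tile m → ℝ) :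
    ∑ U ∈ S.superTile (a + b) T, h U =
      ∑ T' ∈ S.superTile a T, ∑ U ∈ S.superTile b T', h U := by
  rw [superTile_add, Finset.sum_biUnion]
  exact S.pairwiseDisjoint_superTile hP (S.nonOverlapping_superTile a T) b

theorem sum_superTile_move (k : ℕ) (u : Circle) (s : ℂ) (T : Tile m) (h : Tile m → ℝ) :
    ∑ U ∈ S.superTile k (T.move u s), h U =
      ∑ U ∈ S.superTile k T, h (U.move u ((S.factor ^ k : ℝ) * s)) := by
  rw [superTile_move, Finset.sum_image fun _ _ _ _ h => Tile.move_injective _ _ h]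

/-- Every kind of tile occurs in every supertile of some fixed level. -/
theorem IsPrimitive.exists_mem_superTile {S : Substitution m} (hS : S.IsPrimitive) :
    ∃ p, ∀ (i : Fin m) (T : Tile m), ∃ U ∈ S.superTile p T, U.kind = i := by
  obtain ⟨p, -, hp⟩ := hS
  refine ⟨p, fun i T => ?_⟩
  suffices h : ∀ k i, 0 < (S.matrix ^ k) i T.kind → ∃ U ∈ S.superTile k T, U.kind = i from
    h p i (hp i T.kind)
  intro k
  induction k with
  | zero =>
    intro i hi
    refine ⟨T, by simp [superTile_zero], ?_⟩
    by_contra hne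
    simp [Matrix.one_apply_ne (Ne.symm hne)] at hi
  | succ k ih =>
    intro i hi
    rw [pow_succ', Matrix.mul_apply] at hi
    obtain ⟨l, -, hl⟩ := Finset.exists_ne_zero_of_sum_ne_zero hi.ne'
    obtain ⟨h1, h2⟩ := mul_ne_zero_iff.1 hl
    obtain ⟨U, hU, rfl⟩ := ih l (Nat.pos_of_ne_zero h2)
    obtain ⟨V, hV⟩ := Finset.card_pos.1 (Nat.pos_of_ne_zero h1)
    rw [Finset.mem_filter] at hV
    refine ⟨V.move U.rot (S.factor * U.trans), ?_, hV.2⟩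
    rw [superTile_succ, Finset.mem_biUnion]
    exact ⟨U, hU, Finset.mem_image_of_mem _ hV.1⟩

theorem proto_nonempty {S : Substitution m} (hS : S.IsPrimitive) {A : Set (Tile m)}
    (hA : S.IsTiling A) (i : Fin m) : (S.proto i).Nonempty := by
  have h0 : (0 : ℂ) ∈ ⋃ T ∈ A, T.support S.proto := by rw [hA.1]; trivial
  simp only [Set.mem_iUnion] at h0
  obtain ⟨T, -, hT⟩ := h0
  obtain ⟨p, hp⟩ := hS.exists_mem_superTile
  obtain ⟨U, hU, hUk⟩ := hp T.kind ⟨i, 1, 0⟩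
  have hne : (U.support S.proto).Nonempty := by
    rw [Tile.support_eq, Set.image_nonempty, hUk]
    exact Set.image_nonempty.1 ⟨0, hT⟩
  have := hne.mono (S.support_subset_of_mem_superTile hU)
  rw [Set.smul_set_nonempty] at this
  exact Set.image_nonempty.1 this

end Substitution

theorem volume_real_smul {c : ℝ} (hc : 0 ≤ c) (E : Set ℂ) :
    volume.real (c • E) = c ^ 2 * volume.real E := by
  rw [measureReal_def, Measure.addHaar_smul, Complex.finrank_real_complex, ENNReal.toReal_mul,
    ENNReal.toReal_ofReal (abs_nonneg _), abs_of_nonneg (pow_nonneg hc 2), measureReal_def]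

namespace Substitution

variable (S : Substitution m)

/-- The area of a prototile. -/
def area (i : Fin m) : ℝ := volume.real (S.proto i)

/-- The area of the interior of a prototile. -/
def interiorArea (i : Fin m) : ℝ := volume.real (interior (S.proto i))

theorem volume_real_support (T : Tile m) :
    volume.real (T.support S.proto) = S.area T.kind := by
  rw [area, measureReal_def, Tile.support_eq, volume_motion_image, measureReal_def]

theorem volume_real_interior_support (T : Tile m) :
    volume.real (interior (T.support S.proto)) = S.interiorArea T.kind := by
  rw [interiorArea, measureReal_def, Tile.interior_support, volume_motion_image, measureReal_def]

theorem interiorArea_pos (hP : ∀ i, (S.proto i).Nonempty) (i : Fin m) : 0 < S.interiorArea i := by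
  have h : (interior (S.proto i)).Nonempty := by
    rw [← closure_nonempty_iff, S.closure_interior_proto]; exact hP i
  refine ENNReal.toReal_pos (isOpen_interior.measure_pos _ h).ne' ?_
  exact (measure_mono interior_subset).trans_lt (S.isCompact_proto i).measure_lt_top |>.ne

theorem interiorArea_le_area (i : Fin m) : S.interiorArea i ≤ S.area i :=
  measureReal_mono interior_subset (S.isCompact_proto i).measure_lt_top.ne

theorem area_pos (hP : ∀ i, (S.proto i).Nonempty) (i : Fin m) : 0 < S.area i :=
  (S.interiorArea_pos hP i).trans_le (S.interiorArea_le_area i)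

/-- A set covered by finitely many tiles has at most the sum of their areas. -/
theorem volume_real_le_sum_area {B : Finset (Tile m)} {E : Set ℂ}
    (h : E ⊆ ⋃ T ∈ B, T.support S.proto) : volume.real E ≤ ∑ T ∈ B, S.area T.kind := by
  calc volume.real E ≤ volume.real (⋃ T ∈ B, T.support S.proto) :=
        measureReal_mono h
          ((B.finite_toSet.isCompact_biUnion fun T _ => S.isCompact_support T).measure_lt_top.ne)
    _ ≤ ∑ T ∈ B, volume.real (T.support S.proto) := measureReal_biUnion_finset_le _ _
    _ = _ := Finset.sum_congr rfl fun T _ => S.volume_real_support T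

theorem sum_interiorArea_le {B : Finset (Tile m)} (hB : NonOverlapping S.proto (B : Set (Tile m)))
    {E : Set ℂ} (hE : volume E ≠ ⊤) (h : ∀ T ∈ B, interior (T.support S.proto) ⊆ E) :
    ∑ T ∈ B, S.interiorArea T.kind ≤ volume.real E := by
  calc ∑ T ∈ B, S.interiorArea T.kind
      = ∑ T ∈ B, volume.real (interior (T.support S.proto)) :=
        Finset.sum_congr rfl fun T _ => (S.volume_real_interior_support T).symm
    _ = volume.real (⋃ T ∈ B, interior (T.support S.proto)) := by
        rw [measureReal_biUnion_finset hB (fun T _ => isOpen_interior.measurableSet) fun T _ =>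
          ((measure_mono interior_subset).trans_lt (S.isCompact_support T).measure_lt_top).ne]
    _ ≤ volume.real E := measureReal_mono (Set.iUnion₂_subset h) hE

theorem volume_real_smul_support (k : ℕ) (T : Tile m) :
    volume.real (S.factor ^ k • T.support S.proto) = S.factor ^ (2 * k) * S.area T.kind := by
  rw [volume_real_smul (S.factor_pow_pos k).le, volume_real_support, mul_comm 2, pow_mul]

theorem volume_smul_support_ne_top (k : ℕ) (T : Tile m) :
    volume (S.factor ^ k • T.support S.proto) ≠ ⊤ :=
  ((S.isCompact_support T).smul _).measure_lt_top.ne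

theorem le_sum_area_superTile (k : ℕ) (T : Tile m) :
    S.factor ^ (2 * k) * S.area T.kind ≤ ∑ U ∈ S.superTile k T, S.area U.kind := by
  rw [← volume_real_smul_support]
  exact S.volume_real_le_sum_area (S.biUnion_superTile_support k T).ge

theorem sum_interiorArea_superTile_le (k : ℕ) (T : Tile m) :
    ∑ U ∈ S.superTile k T, S.interiorArea U.kind ≤ S.factor ^ (2 * k) * S.interiorArea T.kind := by
  have h : volume.real (S.factor ^ k • interior (T.support S.proto)) =
      S.factor ^ (2 * k) * S.interiorArea T.kind := by
    rw [volume_real_smul (S.factor_pow_pos k).le, volume_real_interior_support, mul_comm 2, pow_mul]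
  rw [← h]
  refine S.sum_interiorArea_le (S.nonOverlapping_superTile k T) ?_
    fun U hU => S.interior_support_subset_of_mem_superTile hU
  exact ((measure_mono (Set.smul_set_mono interior_subset)).trans_lt
    (S.volume_smul_support_ne_top k T).lt_top).ne

/-- A bound for the distance of the points of the prototiles from the origin. -/
theorem exists_radius : ∃ D : ℝ, 0 < D ∧ ∀ i, S.proto i ⊆ Metric.closedBall 0 D := by
  have h : Bornology.IsBounded (⋃ i, S.proto i) :=
    (Bornology.isBounded_iUnion).2 fun i => (S.isCompact_proto i).isBounded
  obtain ⟨D, hD, h⟩ := h.subset_closedBall_lt 0 0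
  exact ⟨D, hD, fun i => (Set.subset_iUnion _ i).trans h⟩

theorem dist_le_of_mem_support {D : ℝ} (hD : ∀ i, S.proto i ⊆ Metric.closedBall 0 D)
    {T : Tile m} {z w : ℂ} (hz : z ∈ T.support S.proto) (hw : w ∈ T.support S.proto) :
    dist z w ≤ 2 * D := by
  obtain ⟨z, hz, rfl⟩ := hz
  obtain ⟨w, hw, rfl⟩ := hw
  have h := (motion T.rot T.trans).dist_eq z w
  rw [motion_apply, motion_apply] at h
  rw [h]
  have h1 := hD _ hz
  have h2 := hD _ hw
  rw [Metric.mem_closedBall] at h1 h2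
  linarith [dist_triangle_right z w 0]

theorem dist_le_of_mem_smul_support {D : ℝ} (hD : ∀ i, S.proto i ⊆ Metric.closedBall 0 D)
    {k : ℕ} {T : Tile m} {z w : ℂ} (hz : z ∈ S.factor ^ k • T.support S.proto)
    (hw : w ∈ S.factor ^ k • T.support S.proto) : dist z w ≤ 2 * D * S.factor ^ k := by
  obtain ⟨z, hz, rfl⟩ := hz
  obtain ⟨w, hw, rfl⟩ := hw
  simp only [dist_smul₀, Real.norm_of_nonneg (S.factor_pow_pos k).le]
  rw [mul_comm]
  exact mul_le_mul_of_nonneg_right (S.dist_le_of_mem_support hD hz hw) (S.factor_pow_pos k).le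

/-- Supertiles of high level contain tiles in the interior of their support. -/
theorem exists_mem_superTile_subset_interior (hP : ∀ i, (S.proto i).Nonempty) (T : Tile m) :
    ∃ k, ∃ U ∈ S.superTile k T,
      U.support S.proto ⊆ S.factor ^ k • interior (T.support S.proto) := by
  obtain ⟨D, -, hD⟩ := S.exists_radius
  obtain ⟨z, hz⟩ := S.interior_support_nonempty hP T
  obtain ⟨ε, hε, hball⟩ := Metric.isOpen_iff.1 isOpen_interior z hz
  obtain ⟨k, hk⟩ := pow_unbounded_of_one_lt (2 * D / ε) S.one_lt_factor
  have hz' : S.factor ^ k • z ∈ ⋃ U ∈ S.superTile k T, U.support S.proto := by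
    rw [biUnion_superTile_support]
    exact Set.smul_mem_smul_set (interior_subset hz)
  simp only [Set.mem_iUnion] at hz'
  obtain ⟨U, hU, hzU⟩ := hz'
  refine ⟨k, U, hU, fun w hw => ?_⟩
  have hd := S.dist_le_of_mem_support hD hw hzU
  rw [Set.mem_smul_set_iff_inv_smul_mem₀ (S.factor_pow_pos k).ne']
  apply hball
  rw [Metric.mem_ball]
  have h1 : dist w (S.factor ^ k • z) = S.factor ^ k * dist ((S.factor ^ k)⁻¹ • w) z := by
    conv_lhs => rw [← smul_inv_smul₀ (S.factor_pow_pos k).ne' w]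
    rw [dist_smul₀, Real.norm_of_nonneg (S.factor_pow_pos k).le]
  rw [div_lt_iff₀ hε] at hk
  have := (h1 ▸ hd).trans_lt hk
  exact lt_of_mul_lt_mul_left this (S.factor_pow_pos k).le

/-- The areas of prototiles and those of their interiors are proportional. -/
theorem exists_area_eq_mul (hS : S.IsPrimitive) (hP : ∀ i, (S.proto i).Nonempty) :
    ∃ c : ℝ, 0 < c ∧ ∀ i, S.area i = c * S.interiorArea i := by
  rcases isEmpty_or_nonempty (Fin m) with hm | hm
  · exact ⟨1, one_pos, fun i => (hm.false i).elim⟩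
  obtain ⟨p, hp⟩ := hS.exists_mem_superTile
  obtain ⟨i, hi⟩ := Finite.exists_max fun i => S.area i / S.interiorArea i
  have hle : ∀ j, S.area j ≤ S.area i / S.interiorArea i * S.interiorArea j := fun j =>
    (div_le_iff₀ (S.interiorArea_pos hP j)).1 (hi j)
  have hc : 0 < S.area i / S.interiorArea i := div_pos (S.area_pos hP i) (S.interiorArea_pos hP i)
  refine ⟨_, hc, fun j => ?_⟩
  have h1 := S.le_sum_area_superTile p ⟨i, 1, 0⟩
  have h2 := mul_le_mul_of_nonneg_left (S.sum_interiorArea_superTile_le p ⟨i, 1, 0⟩) hc.le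
  rw [Finset.mul_sum] at h2
  have h3 : S.area i / S.interiorArea i * (S.factor ^ (2 * p) * S.interiorArea i) =
      S.factor ^ (2 * p) * S.area i := by
    have := (S.interiorArea_pos hP i).ne'
    field_simp
  obtain ⟨U, hU, rfl⟩ := hp j ⟨i, 1, 0⟩
  by_contra hne
  have h4 := Finset.sum_lt_sum (fun V (_ : V ∈ S.superTile p ⟨i, 1, 0⟩) => hle V.kind)
    ⟨U, hU, lt_of_le_of_ne (hle _) hne⟩
  simp only at h2
  linarith

theorem interiorArea_eq_area (hS : S.IsPrimitive) (hP : ∀ i, (S.proto i).Nonempty) (i : Fin m) :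
    S.interiorArea i = S.area i := by
  obtain ⟨c, hc, h⟩ := S.exists_area_eq_mul hS hP
  suffices h1 : c = 1 by rw [h, h1, one_mul]
  obtain ⟨k, U, hU, hUsub⟩ := S.exists_mem_superTile_subset_interior hP ⟨i, 1, 0⟩
  set T : Tile m := ⟨i, 1, 0⟩
  have hfin : volume (S.factor ^ k • interior (T.support S.proto)) ≠ ⊤ :=
    ((measure_mono (Set.smul_set_mono interior_subset)).trans_lt
      (S.volume_smul_support_ne_top k T).lt_top).ne
  have hdisj : Disjoint (U.support S.proto)
      (⋃ V ∈ (S.superTile k T).erase U, interior (V.support S.proto)) := by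
    rw [Set.disjoint_iUnion₂_right]
    intro V hV
    rw [Finset.mem_erase] at hV
    exact (S.disjoint_interior_support (S.nonOverlapping_superTile k T) hV.2 hU hV.1).symm
  have hsub : ⋃ V ∈ (S.superTile k T).erase U, interior (V.support S.proto) ⊆
      S.factor ^ k • interior (T.support S.proto) \ U.support S.proto := by
    rw [Set.subset_sdiff]
    refine ⟨Set.iUnion₂_subset fun V hV => ?_, hdisj.symm⟩
    exact S.interior_support_subset_of_mem_superTile (Finset.mem_of_mem_erase hV)
  have h1 := S.sum_interiorArea_le
    ((S.nonOverlapping_superTile k T).mono (by simp)) (B := (S.superTile k T).erase U)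
    ((measure_mono Set.sdiff_subset).trans_lt hfin.lt_top).ne (fun V hV =>
      (Set.subset_biUnion_of_mem (u := fun V : Tile m => interior (V.support S.proto)) hV).trans hsub)
  rw [measureReal_sdiff hUsub (S.isCompact_support U).measurableSet hfin,
    volume_real_smul (S.factor_pow_pos k).le, volume_real_interior_support,
    volume_real_support] at h1
  have h2 := S.le_sum_area_superTile k T
  rw [← Finset.sum_erase_add _ _ hU] at h2
  simp only [h] at h1 h2
  rw [← Finset.mul_sum, mul_comm 2, pow_mul] at h2
  have h3 := S.interiorArea_pos hP U.kind
  have h4 : c * S.interiorArea U.kind ≤ 1 * S.interiorArea U.kind := by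
    have : c * (∑ V ∈ (S.superTile k T).erase U, S.interiorArea V.kind) ≤
      c * ((S.factor ^ k) ^ 2 * S.interiorArea T.kind - c * S.interiorArea U.kind) :=
      mul_le_mul_of_nonneg_left h1 hc.le
    have h5 : c * (c * S.interiorArea U.kind) ≤ c * (1 * S.interiorArea U.kind) := by linarith
    exact le_of_mul_le_mul_left h5 hc
  have h6 := le_of_mul_le_mul_right h4 h3
  have h7 := S.interiorArea_le_area U.kind
  rw [h, ← one_mul (S.interiorArea U.kind), ← mul_assoc, mul_one] at h7
  exact le_antisymm h6 (le_of_mul_le_mul_right h7 h3)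

theorem sum_area_superTile (hS : S.IsPrimitive) (hP : ∀ i, (S.proto i).Nonempty) (k : ℕ)
    (T : Tile m) :
    ∑ U ∈ S.superTile k T, S.area U.kind = S.factor ^ (2 * k) * S.area T.kind := by
  refine le_antisymm ?_ (S.le_sum_area_superTile k T)
  simpa only [S.interiorArea_eq_area hS hP] using S.sum_interiorArea_superTile_le k T

/-- The areas of non-overlapping tiles in a set add up to at most the area of the set. -/
theorem sum_area_le (hS : S.IsPrimitive) (hP : ∀ i, (S.proto i).Nonempty) {B : Finset (Tile m)}
    (hB : NonOverlapping S.proto (B : Set (Tile m))) {E : Set ℂ} (hE : volume E ≠ ⊤)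
    (h : ∀ T ∈ B, T.support S.proto ⊆ E) : ∑ T ∈ B, S.area T.kind ≤ volume.real E := by
  simpa only [S.interiorArea_eq_area hS hP] using
    S.sum_interiorArea_le hB hE fun T hT => interior_subset.trans (h T hT)

theorem volume_frontier_proto (hS : S.IsPrimitive) (hP : ∀ i, (S.proto i).Nonempty) (i : Fin m) :
    volume (frontier (S.proto i)) = 0 := by
  have h : volume.real (frontier (S.proto i)) = 0 := by
    rw [frontier, (S.isCompact_proto i).isClosed.closure_eq,
      measureReal_sdiff interior_subset isOpen_interior.measurableSet
        (S.isCompact_proto i).measure_lt_top.ne]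
    exact sub_eq_zero.2 (S.interiorArea_eq_area hS hP i).symm
  exact (measureReal_eq_zero_iff
    ((measure_mono (S.isCompact_proto i).isClosed.frontier_subset).trans_lt
      (S.isCompact_proto i).measure_lt_top).ne).1 h

/-- A positive lower bound of the areas of the prototiles. -/
theorem exists_le_area (hP : ∀ i, (S.proto i).Nonempty) : ∃ a : ℝ, 0 < a ∧ ∀ i, a ≤ S.area i := by
  rcases isEmpty_or_nonempty (Fin m) with hm | hm
  · exact ⟨1, one_pos, fun i => (hm.false i).elim⟩
  · obtain ⟨i, hi⟩ := Finite.exists_min S.area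
    exact ⟨_, S.area_pos hP i, hi⟩

theorem card_mul_le (hS : S.IsPrimitive) (hP : ∀ i, (S.proto i).Nonempty) {a : ℝ}
    (ha : ∀ i, a ≤ S.area i) {B : Finset (Tile m)}
    (hB : NonOverlapping S.proto (B : Set (Tile m))) {E : Set ℂ} (hE : volume E ≠ ⊤)
    (h : ∀ T ∈ B, T.support S.proto ⊆ E) : B.card * a ≤ volume.real E := by
  refine le_trans ?_ (S.sum_area_le hS hP hB hE h)
  rw [← nsmul_eq_mul]
  exact Finset.card_nsmul_le_sum _ _ _ fun T _ => ha T.kind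

end Substitution

theorem circle_dist_eq (u v : Circle) : dist u v = ‖(u : ℂ) - v‖ := by
  rw [← dist_eq_norm]; rfl

theorem circle_dist_mul_left (w u v : Circle) : dist (w * u) (w * v) = dist u v := by
  rw [circle_dist_eq, circle_dist_eq, Circle.coe_mul, Circle.coe_mul, ← mul_sub, norm_mul,
    Circle.norm_coe, one_mul]

theorem circle_dist_exp_le (x y : ℝ) : dist (Circle.exp x) (Circle.exp y) ≤ |x - y| := by
  have h : Circle.exp x = Circle.exp y * Circle.exp (x - y) := by
    rw [← Circle.exp_add]; congr 1; ring
  conv_lhs => rw [h, ← mul_one (Circle.exp y), mul_assoc, one_mul, circle_dist_mul_left,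
    circle_dist_eq, Circle.coe_exp, Circle.coe_one, mul_comm]
  exact Real.norm_exp_I_mul_ofReal_sub_one_le

theorem circle_exp_toIcoMod_arg (w : Circle) :
    Circle.exp (toIcoMod Real.two_pi_pos 0 (Complex.arg w)) = w := by
  conv_rhs => rw [← Circle.exp_arg w]
  exact Circle.exp_eq_exp.2 ⟨-toIcoDiv Real.two_pi_pos 0 (Complex.arg w), by
    rw [toIcoMod, zsmul_eq_mul]; push_cast; ring⟩

theorem Tile.exp_orientation (T : Tile m) : Circle.exp T.orientation = T.rot :=
  circle_exp_toIcoMod_arg T.rot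

theorem Equidistributed.exists_mem_Icc {a : ℕ → ℝ} (ha : Equidistributed a) {x y : ℝ} (hx : 0 ≤ x)
    (hxy : x < y) (hy : y < 2 * Real.pi) : ∃ j, a j ∈ Set.Icc x y := by
  by_contra! h
  have h1 := ha x y hx hxy hy
  simp only [fun j => Set.indicator_of_notMem (h j) (fun _ => (1 : ℝ)), Finset.sum_const_zero,
    mul_zero] at h1
  have h2 := tendsto_nhds_unique h1 tendsto_const_nhds
  have h3 : 0 < (y - x) / (2 * Real.pi) := div_pos (sub_pos.2 hxy) Real.two_pi_pos
  exact h3.ne' h2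

namespace Substitution

variable (S : Substitution m)

/-- The `n`-th supertiles of tiles of kind `j` contain tiles of kind `i` with relative
rotation `q`. -/
def Occurs (n : ℕ) (j i : Fin m) (q : Circle) : Prop :=
  ∀ T : Tile m, T.kind = j → ∃ U ∈ S.superTile n T, U.kind = i ∧ U.rot = q * T.rot

variable {S}

theorem Occurs.zero (i : Fin m) : S.Occurs 0 i i 1 := fun T hT =>
  ⟨T, by simp [superTile_zero], hT, by simp⟩

theorem Occurs.comp {a b : ℕ} {j i l : Fin m} {q r : Circle} (h : S.Occurs a j i q)
    (h' : S.Occurs b i l r) : S.Occurs (a + b) j l (r * q) := by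
  intro T hT
  obtain ⟨U, hU, hUi, hUq⟩ := h T hT
  obtain ⟨V, hV, hVl, hVr⟩ := h' U hUi
  refine ⟨V, ?_, hVl, by rw [hVr, hUq, mul_assoc]⟩
  rw [superTile_add, Finset.mem_biUnion]
  exact ⟨U, hU, hV⟩

theorem Occurs.of_mem {n : ℕ} {T U : Tile m} (h : U ∈ S.superTile n T) :
    S.Occurs n T.kind U.kind (U.rot / T.rot) := by
  intro T' hT'
  obtain ⟨s, hs⟩ := Tile.exists_move_eq hT'.symm
  refine ⟨U.move (T'.rot / T.rot) ((S.factor ^ n : ℝ) * s), ?_, rfl, ?_⟩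
  · rw [hs, superTile_move, ← hs]
    exact Finset.mem_image_of_mem _ h
  · simp only [Tile.move]
    rw [div_mul_eq_mul_div, div_mul_eq_mul_div, mul_comm]

theorem IsPrimitive.exists_occurs (hS : S.IsPrimitive) : ∃ p, ∀ j i, ∃ q, S.Occurs p j i q := by
  obtain ⟨p, hp⟩ := hS.exists_mem_superTile
  refine ⟨p, fun j i => ?_⟩
  obtain ⟨U, hU, rfl⟩ := hp i ⟨j, 1, 0⟩
  exact ⟨_, Occurs.of_mem hU⟩

/-- Tiles of the same kind occur in supertiles with arbitrarily small angles between them. -/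
def HasSmallAngles (S : Substitution m) : Prop :=
  ∀ δ > 0, ∃ θ : ℝ, 0 < θ ∧ θ < δ ∧
    ∃ (n : ℕ) (j i : Fin m) (q : Circle), S.Occurs n j i q ∧ S.Occurs n j i (Circle.exp θ * q)

/-- The rotations of the tiles of each kind in the supertiles of some fixed level are
arbitrarily dense in the circle. -/
theorem HasSmallAngles.exists_dist_lt (hS : S.IsPrimitive) (h : S.HasSmallAngles) {δ : ℝ}
    (hδ : 0 < δ) :
    ∃ n, ∀ (T : Tile m) (i : Fin m) (w : Circle),
      ∃ U ∈ S.superTile n T, U.kind = i ∧ dist U.rot w < δ := by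
  obtain ⟨p, hp⟩ := hS.exists_occurs
  obtain ⟨θ, hθ, hθδ, n, j, a, q, h1, h2⟩ := h δ hδ
  obtain ⟨r, hr⟩ := hp a j
  have hN : ∀ N s : ℕ, s ≤ N →
      S.Occurs (N * (p + n)) a a (Circle.exp (s * θ) * (q * r) ^ N) := by
    intro N
    induction N with
    | zero =>
      intro s hs
      obtain rfl : s = 0 := by omega
      simpa using Occurs.zero a
    | succ N ih =>
      intro s hs
      rw [add_mul, one_mul]
      rcases Nat.lt_or_ge N s with hlt | hle
      · obtain rfl : s = N + 1 := by omega
        have := (ih N le_rfl).comp (hr.comp h2)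
        convert this using 1
        push_cast
        rw [add_mul, one_mul, Circle.exp_add, pow_succ]
        simp only [mul_assoc, mul_comm, mul_left_comm]
      · have := (ih s hle).comp (hr.comp h1)
        convert this using 1
        rw [pow_succ]
        simp only [mul_assoc, mul_comm]
  set N := ⌈2 * Real.pi / θ⌉₊ with hNdef
  refine ⟨p + N * (p + n) + p, fun T i w => ?_⟩
  obtain ⟨r₁, hr₁⟩ := hp T.kind a
  obtain ⟨r₂, hr₂⟩ := hp a i
  set c := r₂ * (q * r) ^ N * r₁ * T.rot with hc
  obtain ⟨x, ⟨hx0, hx⟩, hxw⟩ : ∃ x ∈ Set.Ico (0 : ℝ) (0 + 2 * Real.pi), Circle.exp x = w / c :=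
    ⟨_, toIcoMod_mem_Ico _ _ _, circle_exp_toIcoMod_arg _⟩
  rw [zero_add] at hx
  set s := ⌊x / θ⌋₊ with hs
  have hsN : s ≤ N := by
    refine (Nat.floor_le_floor ((div_le_div_iff_of_pos_right hθ).2 hx.le)).trans ?_
    exact Nat.floor_le_ceil _
  have hs1 : s * θ ≤ x := by
    rw [← le_div_iff₀ hθ]; exact Nat.floor_le (div_nonneg hx0 hθ.le)
  have hs2 : x < (s + 1) * θ := by
    rw [← div_lt_iff₀ hθ]; exact Nat.lt_floor_add_one _
  obtain ⟨U, hU, hUi, hUr⟩ := ((hr₁.comp (hN N s hsN)).comp hr₂) T rfl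
  refine ⟨U, hU, hUi, ?_⟩
  have e1 : U.rot = c * Circle.exp (s * θ) := by
    rw [hUr, hc]
    simp only [mul_assoc, mul_comm, mul_left_comm]
  have e2 : w = c * Circle.exp x := by rw [hxw, mul_div_cancel]
  rw [e1, e2, circle_dist_mul_left]
  refine (circle_dist_exp_le _ _).trans_lt ?_
  rw [abs_sub_lt_iff]
  constructor <;> linarith

theorem HasStatisticalCircularSymmetry.hasSmallAngles {A : Set (Tile m)}
    (h : S.HasStatisticalCircularSymmetry A) : S.HasSmallAngles := by
  obtain ⟨T, ⟨-, -, hnum⟩, heq⟩ := h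
  intro δ hδ
  set η := min δ 1 / (m + 1) with hη
  have hm : (0 : ℝ) < m + 1 := by positivity
  have hη0 : 0 < η := div_pos (lt_min hδ one_pos) hm
  have hη1 : (m + 1) * η = min δ 1 := by rw [hη]; field_simp
  have hle : ∀ s : Fin (m + 1), ((s : ℕ) : ℝ) + 1 ≤ m + 1 := fun s => by
    exact_mod_cast s.2
  have hex : ∀ s : Fin (m + 1), ∃ j,
      (T j).orientation ∈ Set.Icc ((s : ℕ) * η) ((s : ℕ) * η + η / 2) := by
    intro s
    refine heq.exists_mem_Icc (by positivity) (by linarith) ?_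
    have h1 := mul_le_mul_of_nonneg_right (hle s) hη0.le
    have h2 := Real.pi_gt_three
    have h3 := min_le_right δ 1
    linarith
  choose j hj using hex
  obtain ⟨s₀, s₁, hne, hk⟩ := Fintype.exists_ne_map_eq_of_card_lt
    (fun s : Fin (m + 1) => (T (j s)).kind) (by simp)
  obtain ⟨s, s', hlt, hk⟩ : ∃ s s' : Fin (m + 1), s < s' ∧ (T (j s)).kind = (T (j s')).kind := by
    rcases lt_or_gt_of_ne hne with h | h
    · exact ⟨_, _, h, hk⟩
    · exact ⟨_, _, h, hk.symm⟩
  have hs := hj s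
  have hs' := hj s'
  refine ⟨(T (j s')).orientation - (T (j s)).orientation, ?_, ?_, ?_⟩
  · have h1 : ((s : ℕ) : ℝ) + 1 ≤ (s' : ℕ) := by exact_mod_cast hlt
    have h2 := mul_le_mul_of_nonneg_right h1 hη0.le
    linarith [hs.2, hs'.1]
  · have h1 := mul_le_mul_of_nonneg_right (hle s') hη0.le
    have h3 := min_le_left δ 1
    have h4 : 0 ≤ ((s : ℕ) : ℝ) * η := by positivity
    linarith [hs.1, hs'.2]
  · obtain ⟨ℓ, hℓ, k, i, -, u, v, hcong⟩ := hnum (max (j s) (j s') + 1)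
    have hmem : ∀ a, a ≤ max (j s) (j s') → ∃ U ∈ S.superTile k ⟨i, 1, 0⟩, U.move u v = T a := by
      intro a ha
      have : T a ∈ T '' {j | j < ℓ} := Set.mem_image_of_mem _ (show a < ℓ by omega)
      rw [hcong, ← coe_superTile_proto] at this
      exact this
    obtain ⟨U, hU, hUT⟩ := hmem (j s) (le_max_left _ _)
    obtain ⟨U', hU', hUT'⟩ := hmem (j s') (le_max_right _ _)
    have hkU : U'.kind = U.kind := by
      have e1 : U.kind = (T (j s)).kind := by rw [← hUT]; rfl
      have e2 : U'.kind = (T (j s')).kind := by rw [← hUT']; rfl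
      rw [e1, e2, hk]
    refine ⟨k, i, U.kind, U.rot / 1, Occurs.of_mem hU, ?_⟩
    have h1 := Occurs.of_mem hU'
    rw [hkU] at h1
    convert h1 using 1
    have e1 : (T (j s)).rot = u * U.rot := by rw [← hUT]; rfl
    have e2 : (T (j s')).rot = u * U'.rot := by rw [← hUT']; rfl
    rw [Circle.exp_sub, Tile.exp_orientation, Tile.exp_orientation, e1, e2,
      mul_div_mul_left_eq_div, div_one, div_mul_cancel, div_one]

variable (S)

/-- The area-weighted average of a function over the tiles of the `k`-th supertile of a tile. -/
def avg (k : ℕ) (g : Tile m → ℝ) (T : Tile m) : ℝ :=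
  (∑ U ∈ S.superTile k T, S.area U.kind * g U) / (S.factor ^ (2 * k) * S.area T.kind)

variable {S}

theorem scaledArea_pos (hP : ∀ i, (S.proto i).Nonempty) (k : ℕ) (i : Fin m) :
    0 < S.factor ^ (2 * k) * S.area i :=
  mul_pos (S.factor_pow_pos _) (S.area_pos hP i)

theorem avg_add (hP : ∀ i, (S.proto i).Nonempty) (a b : ℕ) (g : Tile m → ℝ) (T : Tile m) :
    S.avg (a + b) g T = S.avg a (S.avg b g) T := by
  have h : ∀ U : Tile m, S.area U.kind * S.avg b g U =
      (∑ V ∈ S.superTile b U, S.area V.kind * g V) / S.factor ^ (2 * b) := by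
    intro U
    have h1 := (S.area_pos hP U.kind).ne'
    have h2 := (S.factor_pow_pos (2 * b)).ne'
    rw [avg]; field_simp
  rw [avg, avg, S.sum_superTile_add hP]
  simp only [h, ← Finset.sum_div]
  rw [div_div, mul_add, pow_add]
  congr 1
  ring

/-- The value of an average over a supertile is at most a convex combination of an upper bound of
the function and its value at any of the tiles. -/
theorem avg_le_of_mem (hS : S.IsPrimitive) (hP : ∀ i, (S.proto i).Nonempty) {k : ℕ}
    {g : Tile m → ℝ} {T U : Tile m} {M : ℝ} (hg : ∀ V, g V ≤ M) (hU : U ∈ S.superTile k T) :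
    S.avg k g T ≤ M - S.area U.kind / (S.factor ^ (2 * k) * S.area T.kind) * (M - g U) := by
  have hpos := scaledArea_pos hP k T.kind
  have h1 : ∑ V ∈ S.superTile k T, S.area V.kind * (M - g V) =
      M * (S.factor ^ (2 * k) * S.area T.kind) - ∑ V ∈ S.superTile k T, S.area V.kind * g V := by
    rw [← S.sum_area_superTile hS hP, Finset.mul_sum, ← Finset.sum_sub_distrib]
    exact Finset.sum_congr rfl fun V _ => by ring
  have h2 : S.area U.kind * (M - g U) ≤ ∑ V ∈ S.superTile k T, S.area V.kind * (M - g V) :=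
    Finset.single_le_sum (f := fun V : Tile m => S.area V.kind * (M - g V))
      (fun V _ => mul_nonneg (S.area_pos hP _).le (sub_nonneg.2 (hg V))) hU
  rw [avg, div_le_iff₀ hpos, sub_mul, div_mul_eq_mul_div, div_mul_cancel₀ _ hpos.ne']
  linarith

theorem avg_const (hS : S.IsPrimitive) (hP : ∀ i, (S.proto i).Nonempty) (k : ℕ) (c : ℝ)
    (T : Tile m) : S.avg k (fun _ => c) T = c := by
  rw [avg, ← Finset.sum_mul, S.sum_area_superTile hS hP, mul_div_cancel_left₀]
  exact (scaledArea_pos hP k T.kind).ne'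

theorem avg_mono (hP : ∀ i, (S.proto i).Nonempty) (k : ℕ) {g g' : Tile m → ℝ}
    (h : ∀ T, g T ≤ g' T) (T : Tile m) : S.avg k g T ≤ S.avg k g' T :=
  (div_le_div_iff_of_pos_right (scaledArea_pos hP k T.kind)).2 <|
    Finset.sum_le_sum fun U _ => mul_le_mul_of_nonneg_left (h U) (S.area_pos hP U.kind).le

/-- A function of tiles that depends only on the kind and, continuously, on the rotation. -/
def RotContinuous (g : Tile m → ℝ) : Prop :=
  ∀ ε > 0, ∃ δ > 0, ∀ T T' : Tile m, T.kind = T'.kind → dist T.rot T'.rot < δ → |g T - g T'| ≤ ε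

theorem abs_avg_sub_avg_le (hS : S.IsPrimitive) (hP : ∀ i, (S.proto i).Nonempty) (k : ℕ)
    {g : Tile m → ℝ} {ε δ : ℝ}
    (hg : ∀ T T' : Tile m, T.kind = T'.kind → dist T.rot T'.rot < δ → |g T - g T'| ≤ ε)
    {T T' : Tile m} (hk : T.kind = T'.kind) (hd : dist T.rot T'.rot < δ) :
    |S.avg k g T - S.avg k g T'| ≤ ε := by
  obtain ⟨s, hs⟩ := Tile.exists_move_eq hk
  have hpos := scaledArea_pos hP k T.kind
  rw [avg, avg, ← hk, ← sub_div, abs_div, abs_of_pos hpos, div_le_iff₀ hpos,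
    ← S.sum_area_superTile hS hP, hs, sum_superTile_move, ← Finset.sum_sub_distrib,
    Finset.mul_sum]
  refine (Finset.abs_sum_le_sum_abs _ _).trans (Finset.sum_le_sum fun U _ => ?_)
  simp only [Tile.move]
  rw [← mul_sub, abs_mul, abs_of_pos (S.area_pos hP _), mul_comm ε]
  refine mul_le_mul_of_nonneg_left (hg _ _ rfl ?_) (S.area_pos hP _).le
  have e1 : U.rot = U.rot / T.rot * T.rot := (div_mul_cancel _ _).symm
  have e2 : T'.rot / T.rot * U.rot = U.rot / T.rot * T'.rot := by
    rw [div_mul_eq_mul_div, div_mul_eq_mul_div, mul_comm]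
  have e3 : dist U.rot (T'.rot / T.rot * U.rot) = dist T.rot T'.rot := by
    rw [e2, ← circle_dist_mul_left (U.rot / T.rot) T.rot, ← e1]
  exact e3.trans_lt hd

/-- Averages over supertiles of growing level converge uniformly to a constant. -/
theorem exists_tendsto_avg (hS : S.IsPrimitive) (hP : ∀ i, (S.proto i).Nonempty) [NeZero m]
    (hsm : S.HasSmallAngles) {g : Tile m → ℝ} (hg : RotContinuous g) {C : ℝ}
    (hC : ∀ T, |g T| ≤ C) :
    ∃ l : ℝ, ∀ ε > 0, ∃ K, ∀ k ≥ K, ∀ T, |S.avg k g T - l| ≤ ε := by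
  have : Nonempty (Tile m) := ⟨⟨0, 1, 0⟩⟩
  have hub : ∀ k T, S.avg k g T ≤ C := fun k T =>
    (avg_mono hP k (fun U => (abs_le.1 (hC U)).2) T).trans_eq (avg_const hS hP k C T)
  have hlb : ∀ k T, -C ≤ S.avg k g T := fun k T =>
    (avg_const hS hP k (-C) T).symm.trans_le (avg_mono hP k (fun U => (abs_le.1 (hC U)).1) T)
  have hbdd : ∀ k, BddAbove (Set.range (S.avg k g)) := fun k =>
    ⟨C, by rintro _ ⟨T, rfl⟩; exact hub k T⟩
  have hbdd' : ∀ k, BddBelow (Set.range (S.avg k g)) := fun k =>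
    ⟨-C, by rintro _ ⟨T, rfl⟩; exact hlb k T⟩
  set M : ℕ → ℝ := fun k => ⨆ T, S.avg k g T with hM
  set μ : ℕ → ℝ := fun k => ⨅ T, S.avg k g T with hμ
  have hleM : ∀ k T, S.avg k g T ≤ M k := fun k T => le_ciSup (hbdd k) T
  have hμle : ∀ k T, μ k ≤ S.avg k g T := fun k T => ciInf_le (hbdd' k) T
  have hManti : Antitone M := by
    refine antitone_nat_of_succ_le fun k => ciSup_le fun T => ?_
    rw [add_comm, avg_add hP]
    exact (avg_mono hP 1 (hleM k) T).trans_eq (avg_const hS hP 1 _ T)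
  have hμmono : Monotone μ := by
    refine monotone_nat_of_le_succ fun k => le_ciInf fun T => ?_
    rw [add_comm, avg_add hP]
    exact (avg_const hS hP 1 _ T).symm.trans_le (avg_mono hP 1 (hμle k) T)
  have T₀ : Tile m := ⟨0, 1, 0⟩
  have hMlim := tendsto_atTop_ciInf hManti
    ⟨-C, by rintro _ ⟨k, rfl⟩; exact (hlb k T₀).trans (hleM k T₀)⟩
  have hμlim := tendsto_atTop_ciSup hμmono
    ⟨C, by rintro _ ⟨k, rfl⟩; exact (hμle k T₀).trans (hub k T₀)⟩
  set Minf := ⨅ k, M k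
  set μsup := ⨆ k, μ k
  have hkey : ∀ ε > 0, Minf ≤ μsup + 2 * ε := by
    intro ε hε
    obtain ⟨δ, hδ, hgδ⟩ := hg ε hε
    obtain ⟨n, hn⟩ := hsm.exists_dist_lt hS hδ
    obtain ⟨a, ha, hamin⟩ := S.exists_le_area hP
    obtain ⟨i, hi⟩ := Finite.exists_max S.area
    set c := a / (S.factor ^ (2 * n) * S.area i) with hc
    have hc0 : 0 < c := div_pos ha (scaledArea_pos hP n i)
    have hstep : ∀ k, M (n + k) ≤ M k - c * (M k - (μ k + 2 * ε)) := by
      intro k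
      refine ciSup_le fun T => ?_
      obtain ⟨T₁, hT₁⟩ := exists_lt_of_ciInf_lt (show μ k < μ k + ε by linarith)
      obtain ⟨U, hU, hUk, hUd⟩ := hn T T₁.kind T₁.rot
      have h1 := abs_avg_sub_avg_le hS hP k hgδ hUk hUd
      have h2 : S.avg k g U ≤ μ k + 2 * ε := by
        have := (abs_le.1 h1).2
        linarith
      rw [avg_add hP]
      have h3 := avg_le_of_mem hS hP (hleM k) hU
      refine h3.trans ?_
      have h4 : c ≤ S.area U.kind / (S.factor ^ (2 * n) * S.area T.kind) :=
        div_le_div₀ (S.area_pos hP _).le (hamin _) (scaledArea_pos hP n _)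
          (mul_le_mul_of_nonneg_left (hi _) (S.factor_pow_pos _).le)
      have h5 := mul_le_mul_of_nonneg_right h4 (sub_nonneg.2 (hleM k U))
      have h6 := mul_le_mul_of_nonneg_left (sub_le_sub_left h2 (M k)) hc0.le
      linarith
    have hl1 : Tendsto (fun k => M (n + k)) atTop (𝓝 Minf) := by
      simpa only [add_comm n] using (tendsto_add_atTop_iff_nat n).2 hMlim
    have hl2 := hMlim.sub ((hMlim.sub (hμlim.add_const (2 * ε))).const_mul c)
    have h := le_of_tendsto_of_tendsto' hl1 hl2 hstep
    by_contra! hlt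
    have := mul_pos hc0 (sub_pos.2 hlt)
    linarith
  have hle : Minf ≤ μsup := by
    refine le_of_forall_pos_le_add fun ε hε => ?_
    have := hkey (ε / 2) (by linarith)
    linarith
  refine ⟨Minf, fun ε hε => ?_⟩
  have e1 := hMlim.eventually (gt_mem_nhds (show Minf < Minf + ε by linarith))
  have e2 := hμlim.eventually (lt_mem_nhds (show μsup - ε < μsup by linarith))
  obtain ⟨K, hK⟩ := (e1.and e2).exists_forall_of_atTop
  refine ⟨K, fun k hk T => ?_⟩
  obtain ⟨h1, h2⟩ := hK k hk
  have := hleM k T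
  have := hμle k T
  rw [abs_le]
  constructor <;> linarith

end Substitution

theorem volume_real_closedBall (z : ℂ) {r : ℝ} (hr : 0 ≤ r) :
    volume.real (Metric.closedBall z r) = Real.pi * r ^ 2 := by
  rw [measureReal_def, Complex.volume_closedBall, ENNReal.toReal_mul, ENNReal.toReal_pow,
    ENNReal.toReal_ofReal hr, mul_comm]
  rfl

/-- The control point of a tile. -/
def Tile.point (x : Fin m → ℂ) (T : Tile m) : ℂ := T.rot * x T.kind + T.trans

theorem Tile.point_move (x : Fin m → ℂ) (u : Circle) (s : ℂ) (T : Tile m) :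
    (T.move u s).point x = u * T.point x + s := by
  simp only [point, move, Circle.coe_mul]; ring

/-- The sum of the values of a function at the differences of the control points of a patch. -/
def pairSum (x : Fin m → ℂ) (f : ℂ → ℝ) (B : Finset (Tile m)) : ℝ :=
  ∑ a ∈ B.image (Tile.point x), ∑ b ∈ B.image (Tile.point x), f (a - b)

/-- The contribution of a tile to `pairSum`. -/
def localSum (x : Fin m → ℂ) (f : ℂ → ℝ) (B : Finset (Tile m)) (T : Tile m) : ℝ :=
  (∑ b ∈ B.image (Tile.point x), f (T.point x - b)) / (B.filter fun U => U.point x = T.point x).card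

theorem pairSum_eq_sum_localSum (x : Fin m → ℂ) (f : ℂ → ℝ) (B : Finset (Tile m)) :
    pairSum x f B = ∑ T ∈ B, localSum x f B T := by
  rw [pairSum, ← Finset.sum_fiberwise_of_maps_to (s := B) (g := Tile.point x)
    (t := B.image (Tile.point x)) fun T hT => Finset.mem_image_of_mem _ hT]
  refine Finset.sum_congr rfl fun a ha => ?_
  have h : ∀ T ∈ B.filter (fun T => T.point x = a), localSum x f B T =
      (∑ b ∈ B.image (Tile.point x), f (a - b)) / (B.filter fun U => U.point x = a).card := by
    intro T hT
    rw [localSum, (Finset.mem_filter.1 hT).2]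
  rw [Finset.sum_congr rfl h, Finset.sum_const, nsmul_eq_mul, mul_div_cancel₀]
  obtain ⟨T, hT, hTa⟩ := Finset.mem_image.1 ha
  exact Nat.cast_ne_zero.2 (Finset.card_ne_zero_of_mem (Finset.mem_filter.2 ⟨hT, hTa⟩))

theorem pairSum_image_move (x : Fin m → ℂ) (f : ℂ → ℝ) (B : Finset (Tile m)) (u : Circle) (s : ℂ) :
    pairSum x f (B.image (Tile.move u s)) = pairSum x (fun z => f (u * z)) B := by
  have h : (B.image (Tile.move u s)).image (Tile.point x) =
      (B.image (Tile.point x)).image (motion u s) := by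
    simp only [Finset.image_image]
    exact Finset.image_congr fun T _ => Tile.point_move x u s T
  simp only [pairSum, h]
  rw [Finset.sum_image fun _ _ _ _ h => (motion u s).injective h]
  refine Finset.sum_congr rfl fun a _ => ?_
  rw [Finset.sum_image fun _ _ _ _ h => (motion u s).injective h]
  refine Finset.sum_congr rfl fun b _ => ?_
  congr 1
  simp only [motion_apply]; ring

namespace Substitution

variable {S : Substitution m}

theorem point_mem_support {x : Fin m → ℂ} (hx : ∀ i, x i ∈ S.proto i) (T : Tile m) :
    T.point x ∈ T.support S.proto :=
  Set.mem_image_of_mem _ (hx T.kind)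

/-- The tiles of a patch whose control points have distance at most `ρ` to the complement of the
patch. -/
def boundary (S : Substitution m) (x : Fin m → ℂ) (ρ : ℝ) (B : Finset (Tile m)) :
    Finset (Tile m) := by
  classical
  exact B.filter fun T => ¬ Metric.closedBall (T.point x) ρ ⊆ ⋃ U ∈ B, U.support S.proto

theorem mem_boundary {x : Fin m → ℂ} {ρ : ℝ} {B : Finset (Tile m)} {T : Tile m} :
    T ∈ S.boundary x ρ B ↔
      T ∈ B ∧ ¬ Metric.closedBall (T.point x) ρ ⊆ ⋃ U ∈ B, U.support S.proto := by
  simp [boundary]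

theorem exists_abs_localSum_le (hS : S.IsPrimitive) (hP : ∀ i, (S.proto i).Nonempty)
    {x : Fin m → ℂ} (hx : ∀ i, x i ∈ S.proto i) {f : ℂ → ℝ} {ρ : ℝ} (hρ : 0 ≤ ρ)
    (hf : ∀ z, ρ < ‖z‖ → f z = 0) {c : ℝ} (hc : ∀ z, |f z| ≤ c) :
    ∃ C, 0 ≤ C ∧ ∀ B : Finset (Tile m), NonOverlapping S.proto (B : Set (Tile m)) →
      ∀ T ∈ B, |localSum x f B T| ≤ C := by
  obtain ⟨D, hD0, hD⟩ := S.exists_radius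
  obtain ⟨a, ha0, ha⟩ := S.exists_le_area hP
  have hc0 : 0 ≤ c := (abs_nonneg _).trans (hc 0)
  refine ⟨Real.pi * (ρ + 2 * D) ^ 2 / a * c, by positivity, fun B hB T hT => ?_⟩
  set N := B.filter fun U => dist (U.point x) (T.point x) ≤ ρ
  have h1 : (N.card : ℝ) * a ≤ Real.pi * (ρ + 2 * D) ^ 2 := by
    rw [← volume_real_closedBall (T.point x) (by positivity)]
    refine S.card_mul_le hS hP ha (hB.mono (Finset.coe_subset.2 (Finset.filter_subset _ _)))
      measure_closedBall_lt_top.ne fun U hU z hz => ?_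
    rw [Finset.mem_filter] at hU
    have := S.dist_le_of_mem_support hD hz (point_mem_support hx U)
    rw [Metric.mem_closedBall]
    linarith [dist_triangle z (U.point x) (T.point x), hU.2]
  have h2 : |∑ b ∈ B.image (Tile.point x), f (T.point x - b)| ≤ N.card * c := by
    have h3 : ∑ b ∈ N.image (Tile.point x), f (T.point x - b) =
        ∑ b ∈ B.image (Tile.point x), f (T.point x - b) := by
      refine Finset.sum_subset (Finset.image_subset_image (Finset.filter_subset _ _)) ?_
      intro b hb hbN
      obtain ⟨U, hU, rfl⟩ := Finset.mem_image.1 hb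
      refine hf _ (not_le.1 fun hle => hbN (Finset.mem_image_of_mem _ ?_))
      rw [← dist_eq_norm, dist_comm] at hle
      exact Finset.mem_filter.2 ⟨hU, hle⟩
    rw [← h3]
    refine (Finset.abs_sum_le_sum_abs _ _).trans ((Finset.sum_le_card_nsmul _ _ c
      fun b _ => hc _).trans ?_)
    rw [nsmul_eq_mul]
    exact mul_le_mul_of_nonneg_right (Nat.cast_le.2 Finset.card_image_le) hc0
  have h4 : (1 : ℝ) ≤ (B.filter fun U => U.point x = T.point x).card :=
    Nat.one_le_cast.2 (Finset.card_pos.2 ⟨T, Finset.mem_filter.2 ⟨hT, rfl⟩⟩)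
  rw [localSum, abs_div, abs_of_pos (zero_lt_one.trans_le h4)]
  refine (div_le_self (abs_nonneg _) h4).trans (h2.trans ?_)
  exact mul_le_mul_of_nonneg_right ((le_div_iff₀ ha0).2 h1) hc0

theorem localSum_eq (hP : ∀ i, (S.proto i).Nonempty)
    {x : Fin m → ℂ} (hx : ∀ i, x i ∈ S.proto i) {D : ℝ}
    (hD : ∀ i, S.proto i ⊆ Metric.closedBall 0 D) {f : ℂ → ℝ} {ρ : ℝ} (hρ : 0 ≤ ρ)
    (hf : ∀ z, ρ < ‖z‖ → f z = 0) {B B' : Finset (Tile m)}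
    (hB : NonOverlapping S.proto (B : Set (Tile m))) (hsub : B' ⊆ B) {T : Tile m}
    (hT : T ∈ B') (hT' : T ∉ S.boundary x (ρ + 2 * D) B') :
    localSum x f B T = localSum x f B' T := by
  have hball : Metric.closedBall (T.point x) (ρ + 2 * D) ⊆ ⋃ U ∈ B', U.support S.proto := by
    by_contra h
    exact hT' (mem_boundary.2 ⟨hT, h⟩)
  have key : ∀ U ∈ B, dist (U.point x) (T.point x) ≤ ρ → U ∈ B' := by
    intro U hU hd
    by_contra hUB'
    obtain ⟨z, hz⟩ := S.interior_support_nonempty hP U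
    have hz' : z ∈ ⋃ V ∈ B', V.support S.proto := by
      apply hball
      have := S.dist_le_of_mem_support hD (interior_subset hz) (point_mem_support hx U)
      rw [Metric.mem_closedBall]
      linarith [dist_triangle z (U.point x) (T.point x)]
    simp only [Set.mem_iUnion] at hz'
    obtain ⟨V, hV, hzV⟩ := hz'
    have hne : U ≠ V := fun h => hUB' (h ▸ hV)
    exact Set.disjoint_left.1 (S.disjoint_interior_support hB hU (hsub hV) hne) hz hzV
  have h1 : ∑ b ∈ B'.image (Tile.point x), f (T.point x - b) =
      ∑ b ∈ B.image (Tile.point x), f (T.point x - b) := by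
    refine Finset.sum_subset (Finset.image_subset_image hsub) ?_
    intro b hb hbN
    obtain ⟨U, hU, rfl⟩ := Finset.mem_image.1 hb
    refine hf _ (not_le.1 fun hle => hbN (Finset.mem_image_of_mem _ (key U hU ?_)))
    rwa [← dist_eq_norm, dist_comm] at hle
  have h2 : (B.filter fun U => U.point x = T.point x) =
      B'.filter fun U => U.point x = T.point x := by
    ext U
    simp only [Finset.mem_filter]
    refine ⟨fun h => ⟨key U h.1 ?_, h.2⟩, fun h => ⟨hsub h.1, h.2⟩⟩
    rw [h.2, dist_self]; exact hρ
  rw [localSum, localSum, h1, h2]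

/-- Almost additivity of `pairSum`. -/
theorem abs_pairSum_sub_sum_le (hP : ∀ i, (S.proto i).Nonempty)
    {x : Fin m → ℂ} (hx : ∀ i, x i ∈ S.proto i) {D : ℝ}
    (hD : ∀ i, S.proto i ⊆ Metric.closedBall 0 D) {f : ℂ → ℝ} {ρ : ℝ} (hρ : 0 ≤ ρ)
    (hf : ∀ z, ρ < ‖z‖ → f z = 0) {C : ℝ}
    (hC : ∀ B : Finset (Tile m), NonOverlapping S.proto (B : Set (Tile m)) →
      ∀ T ∈ B, |localSum x f B T| ≤ C)
    {B : Finset (Tile m)} (hB : NonOverlapping S.proto (B : Set (Tile m)))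
    {ι : Type*} (I : Finset ι) (p : ι → Finset (Tile m))
    (hp : (I : Set ι).PairwiseDisjoint p) (hpB : ∀ i ∈ I, p i ⊆ B) :
    |pairSum x f B - ∑ i ∈ I, pairSum x f (p i)| ≤
      C * ((B \ I.biUnion p).card + 2 * ∑ i ∈ I, ((S.boundary x (ρ + 2 * D) (p i)).card : ℝ)) := by
  have hsub : I.biUnion p ⊆ B := Finset.biUnion_subset.2 hpB
  have h1 : pairSum x f B = ∑ T ∈ B \ I.biUnion p, localSum x f B T +
      ∑ i ∈ I, ∑ T ∈ p i, localSum x f B T := by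
    rw [pairSum_eq_sum_localSum, ← Finset.sum_biUnion hp, Finset.sum_sdiff hsub]
  have h2 : |∑ T ∈ B \ I.biUnion p, localSum x f B T| ≤ C * (B \ I.biUnion p).card := by
    refine (Finset.abs_sum_le_sum_abs _ _).trans ((Finset.sum_le_card_nsmul _ _ C
      fun T hT => hC B hB T (Finset.sdiff_subset hT)).trans_eq ?_)
    rw [nsmul_eq_mul, mul_comm]
  have h3 : ∀ i ∈ I, |∑ T ∈ p i, localSum x f B T - pairSum x f (p i)| ≤
      2 * C * (S.boundary x (ρ + 2 * D) (p i)).card := by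
    intro i hi
    have hsubi : S.boundary x (ρ + 2 * D) (p i) ⊆ p i := fun T hT => (mem_boundary.1 hT).1
    rw [pairSum_eq_sum_localSum, ← Finset.sum_sub_distrib]
    have h4 : ∑ T ∈ S.boundary x (ρ + 2 * D) (p i), (localSum x f B T - localSum x f (p i) T) =
        ∑ T ∈ p i, (localSum x f B T - localSum x f (p i) T) := by
      refine Finset.sum_subset hsubi fun T hT hT' => ?_
      rw [localSum_eq hP hx hD hρ hf hB (hpB i hi) hT hT', sub_self]
    rw [← h4]
    refine (Finset.abs_sum_le_sum_abs _ _).trans ((Finset.sum_le_card_nsmul _ _ (2 * C)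
      fun T hT => ?_).trans_eq ?_)
    · refine (abs_sub _ _).trans ?_
      have e1 := hC B hB T (hpB i hi (hsubi hT))
      have e2 := hC (p i) (hB.mono (Finset.coe_subset.2 (hpB i hi))) T (hsubi hT)
      linarith
    · rw [nsmul_eq_mul, mul_comm]
  have h5 : |∑ i ∈ I, (∑ T ∈ p i, localSum x f B T - pairSum x f (p i))| ≤
      ∑ i ∈ I, 2 * C * (S.boundary x (ρ + 2 * D) (p i)).card :=
    (Finset.abs_sum_le_sum_abs _ _).trans (Finset.sum_le_sum h3)
  rw [← Finset.mul_sum, Finset.sum_sub_distrib] at h5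
  rw [h1, add_sub_assoc]
  refine (abs_add_le _ _).trans ?_
  linarith

/-- The part of a prototile near its boundary has small area. -/
theorem exists_volume_cthickening_le (hS : S.IsPrimitive) (hP : ∀ i, (S.proto i).Nonempty)
    {ε : ℝ} (hε : 0 < ε) :
    ∃ δ > 0, ∀ i, volume.real (S.proto i ∩ Metric.cthickening δ (S.proto i)ᶜ) ≤ ε := by
  have hev : ∀ i, ∀ᶠ δ in 𝓝[>] (0 : ℝ),
      volume.real (S.proto i ∩ Metric.cthickening δ (S.proto i)ᶜ) ≤ ε := by
    intro i
    have hfin := (S.isCompact_proto i).measure_lt_top (μ := volume)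
    have : IsFiniteMeasure (volume.restrict (S.proto i)) := ⟨by simpa using hfin⟩
    have h := tendsto_measure_cthickening (μ := volume.restrict (S.proto i)) (s := (S.proto i)ᶜ)
      ⟨1, one_pos, measure_ne_top _ _⟩
    have h0 : volume.restrict (S.proto i) (closure (S.proto i)ᶜ) = 0 := by
      rw [Measure.restrict_apply isClosed_closure.measurableSet]
      have : closure (S.proto i)ᶜ ∩ S.proto i = frontier (S.proto i) := by
        rw [frontier_eq_closure_inter_closure, (S.isCompact_proto i).isClosed.closure_eq,
          Set.inter_comm]
      rw [this, S.volume_frontier_proto hS hP]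
    rw [h0] at h
    have h1 := (h.mono_left nhdsWithin_le_nhds).eventually_le_const
      (show (0 : ENNReal) < ENNReal.ofReal ε by simpa using hε) (l := 𝓝[>] (0 : ℝ))
    filter_upwards [h1] with δ hδ
    rw [Measure.restrict_apply Metric.isClosed_cthickening.measurableSet, Set.inter_comm] at hδ
    exact ENNReal.toReal_le_of_le_ofReal hε.le hδ
  obtain ⟨δ, h1, h2⟩ := ((eventually_all.2 hev).and self_mem_nhdsWithin).exists
  exact ⟨δ, h2, h1⟩

/-- Only a small proportion of the tiles of a supertile of high level is near the boundary. -/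
theorem exists_card_boundary_le (hS : S.IsPrimitive) (hP : ∀ i, (S.proto i).Nonempty)
    {x : Fin m → ℂ} (hx : ∀ i, x i ∈ S.proto i) {ρ : ℝ} {ε : ℝ} (hε : 0 < ε) :
    ∃ K, ∀ k ≥ K, ∀ T : Tile m,
      ((S.boundary x ρ (S.superTile k T)).card : ℝ) ≤ ε * (S.factor ^ (2 * k) * S.area T.kind) := by
  obtain ⟨D, hD0, hD⟩ := S.exists_radius
  obtain ⟨a, ha0, ha⟩ := S.exists_le_area hP
  obtain ⟨δ, hδ0, hδ⟩ := exists_volume_cthickening_le hS hP (ε := ε * a * a) (by positivity)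
  obtain ⟨K, hK⟩ := pow_unbounded_of_one_lt ((ρ + 2 * D) / δ) S.one_lt_factor
  refine ⟨K, fun k hk T => ?_⟩
  have hk' : ρ + 2 * D ≤ δ * S.factor ^ k := by
    rw [← div_le_iff₀' hδ0]
    exact hK.le.trans (pow_le_pow_right₀ S.one_lt_factor.le hk)
  set E := S.proto T.kind ∩ Metric.cthickening δ (S.proto T.kind)ᶜ with hE
  have hEfin : volume E ≠ ⊤ := ((measure_mono Set.inter_subset_left).trans_lt
    (S.isCompact_proto T.kind).measure_lt_top).ne
  have hvol : volume.real (S.factor ^ k • motion T.rot T.trans '' E) =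
      S.factor ^ (2 * k) * volume.real E := by
    rw [volume_real_smul (S.factor_pow_pos k).le, measureReal_def, volume_motion_image,
      ← measureReal_def, mul_comm 2, pow_mul]
  have hfin : volume (S.factor ^ k • motion T.rot T.trans '' E) ≠ ⊤ := by
    rw [Measure.addHaar_smul, volume_motion_image]
    exact ENNReal.mul_ne_top ENNReal.ofReal_ne_top hEfin
  have hsub : ∀ U ∈ S.boundary x ρ (S.superTile k T),
      U.support S.proto ⊆ S.factor ^ k • motion T.rot T.trans '' E := by
    intro U hU z hz
    obtain ⟨hU, hUb⟩ := mem_boundary.1 hU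
    rw [biUnion_superTile_support, Set.not_subset] at hUb
    obtain ⟨w, hw, hwT⟩ := hUb
    obtain ⟨_, ⟨z', hz', rfl⟩, rfl⟩ := S.support_subset_of_mem_superTile hU hz
    refine Set.smul_mem_smul_set (Set.mem_image_of_mem _ ⟨hz', ?_⟩)
    obtain ⟨w', rfl⟩ : ∃ w', S.factor ^ k • motion T.rot T.trans w' = w :=
      ⟨(motion T.rot T.trans).symm ((S.factor ^ k)⁻¹ • w), by
        rw [IsometryEquiv.apply_symm_apply, smul_inv_smul₀ (S.factor_pow_pos k).ne']⟩
    have hw' : w' ∉ S.proto T.kind := fun h =>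
      hwT (Set.smul_mem_smul_set (Set.mem_image_of_mem _ h))
    refine Metric.mem_cthickening_of_dist_le z' w' δ _ hw' ?_
    have h1 := S.dist_le_of_mem_support hD hz (point_mem_support hx U)
    rw [Metric.mem_closedBall] at hw
    have h2 : dist (S.factor ^ k • motion T.rot T.trans z')
        (S.factor ^ k • motion T.rot T.trans w') = S.factor ^ k * dist z' w' := by
      rw [dist_smul₀, Real.norm_of_nonneg (S.factor_pow_pos k).le, IsometryEquiv.dist_eq]
    have h3 : S.factor ^ k * dist z' w' ≤ S.factor ^ k * δ := by
      rw [← h2]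
      refine (dist_triangle_right _ _ (U.point x)).trans ?_
      refine (add_le_add h1 hw).trans ?_
      linarith
    exact le_of_mul_le_mul_left h3 (S.factor_pow_pos k)
  have hno : NonOverlapping S.proto (S.boundary x ρ (S.superTile k T) : Set (Tile m)) :=
    (S.nonOverlapping_superTile k T).mono fun U hU => (mem_boundary.1 hU).1
  have h1 := S.card_mul_le hS hP ha hno hfin hsub
  rw [hvol] at h1
  have h2 := mul_le_mul_of_nonneg_left (hδ T.kind) (S.factor_pow_pos (2 * k)).le
  have h3 := mul_le_mul_of_nonneg_left (ha T.kind)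
    (mul_pos hε (S.factor_pow_pos (2 * k))).le
  refine le_of_mul_le_mul_right ?_ ha0
  have h4 := mul_le_mul_of_nonneg_right h3 ha0.le
  linarith

end Substitution

namespace Substitution

variable {S : Substitution m}

/-- The value of `pairSum` at a supertile, divided by its area. -/
def pairDensity (S : Substitution m) (x : Fin m → ℂ) (f : ℂ → ℝ) (k : ℕ) (T : Tile m) : ℝ :=
  pairSum x f (S.superTile k T) / (S.factor ^ (2 * k) * S.area T.kind)

theorem pairDensity_mul (hP : ∀ i, (S.proto i).Nonempty) (x : Fin m → ℂ) (f : ℂ → ℝ) (k : ℕ)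
    (T : Tile m) :
    pairSum x f (S.superTile k T) =
      S.pairDensity x f k T * (S.factor ^ (2 * k) * S.area T.kind) :=
  (div_mul_cancel₀ _ (scaledArea_pos hP k T.kind).ne').symm

theorem pairDensity_move (x : Fin m → ℂ) (f : ℂ → ℝ) (k : ℕ) (u : Circle) (s : ℂ) (T : Tile m) :
    S.pairDensity x f k (T.move u s) = S.pairDensity x (fun z => f (u * z)) k T := by
  rw [pairDensity, superTile_move, pairSum_image_move]
  rfl

theorem rotContinuous_pairDensity (x : Fin m → ℂ) {f : ℂ → ℝ} (hf : Continuous f) (k : ℕ) :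
    RotContinuous (S.pairDensity x f k) := by
  intro ε hε
  have hcont : ∀ i, UniformContinuous fun u : Circle =>
      S.pairDensity x (fun z => f (u * z)) k ⟨i, 1, 0⟩ := by
    intro i
    refine CompactSpace.uniformContinuous_of_continuous (Continuous.div_const ?_ _)
    refine continuous_finsetSum _ fun a _ => continuous_finsetSum _ fun b _ => ?_
    exact hf.comp (continuous_subtype_val.mul continuous_const)
  have hex : ∀ i, ∃ δ > 0, ∀ u v : Circle, dist u v < δ →
      dist (S.pairDensity x (fun z => f (u * z)) k ⟨i, 1, 0⟩)
        (S.pairDensity x (fun z => f (v * z)) k ⟨i, 1, 0⟩) < ε := fun i =>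
    let ⟨δ, hδ, h⟩ := Metric.uniformContinuous_iff.1 (hcont i) ε hε
    ⟨δ, hδ, fun _ _ huv => h huv⟩
  choose δ hδ hδε using hex
  obtain ⟨δ', hδ'0, hδ'⟩ : ∃ δ' > 0, ∀ i, δ' ≤ δ i := by
    rcases isEmpty_or_nonempty (Fin m) with hm | hm
    · exact ⟨1, one_pos, fun i => (hm.false i).elim⟩
    · obtain ⟨i, hi⟩ := Finite.exists_min δ
      exact ⟨_, hδ i, hi⟩
  have hT : ∀ T : Tile m, S.pairDensity x f k T =
      S.pairDensity x (fun z => f (T.rot * z)) k ⟨T.kind, 1, 0⟩ := by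
    intro T
    rw [← pairDensity_move x f k T.rot T.trans]
    congr 1
    ext <;> simp [Tile.move]
  refine ⟨δ', hδ'0, fun T T' hk hd => ?_⟩
  rw [hT T, hT T', ← hk]
  exact (hδε T.kind _ _ (hd.trans_le (hδ' _))).le

theorem abs_pairDensity_le (hS : S.IsPrimitive) (hP : ∀ i, (S.proto i).Nonempty)
    {x : Fin m → ℂ} {f : ℂ → ℝ} {C : ℝ} (hC0 : 0 ≤ C)
    (hC : ∀ B : Finset (Tile m), NonOverlapping S.proto (B : Set (Tile m)) →
      ∀ T ∈ B, |localSum x f B T| ≤ C) {a : ℝ} (ha0 : 0 < a) (ha : ∀ i, a ≤ S.area i)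
    (k : ℕ) (T : Tile m) : |S.pairDensity x f k T| ≤ C / a := by
  have hpos := scaledArea_pos hP k T.kind
  rw [pairDensity, abs_div, abs_of_pos hpos, div_le_iff₀ hpos, ← S.sum_area_superTile hS hP,
    pairSum_eq_sum_localSum, Finset.mul_sum]
  refine (Finset.abs_sum_le_sum_abs _ _).trans (Finset.sum_le_sum fun U hU => ?_)
  refine (hC _ (S.nonOverlapping_superTile k T) U hU).trans ?_
  rw [div_mul_eq_mul_div, le_div_iff₀ ha0]
  exact mul_le_mul_of_nonneg_left (ha _) hC0

theorem exists_bounds {f : ℂ → ℝ} (hf : Continuous f) (hf' : HasCompactSupport f) :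
    ∃ ρ, 0 ≤ ρ ∧ (∀ z, ρ < ‖z‖ → f z = 0) ∧ ∃ c, ∀ z, |f z| ≤ c := by
  obtain ⟨ρ, hρ, h⟩ := hf'.isCompact.isBounded.subset_closedBall_lt 0 0
  refine ⟨ρ, hρ.le, fun z hz => ?_, hf.bounded_above_of_compact_support hf'⟩
  refine image_eq_zero_of_notMem_tsupport fun hz' => ?_
  have := h hz'
  rw [mem_closedBall_zero_iff] at this
  linarith

/-- The pair densities of supertiles of growing level converge uniformly to a constant. -/
theorem exists_tendsto_pairDensity (hS : S.IsPrimitive) (hP : ∀ i, (S.proto i).Nonempty) [NeZero m]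
    (hsm : S.HasSmallAngles) {x : Fin m → ℂ} (hx : ∀ i, x i ∈ S.proto i) {f : ℂ → ℝ}
    (hf : Continuous f) (hf' : HasCompactSupport f) :
    ∃ l : ℝ, ∀ ε > 0, ∃ K, ∀ k ≥ K, ∀ T, |S.pairDensity x f k T - l| ≤ ε := by
  obtain ⟨ρ, hρ, hfρ, c, hc⟩ := exists_bounds hf hf'
  obtain ⟨C, hC0, hC⟩ := exists_abs_localSum_le hS hP hx hρ hfρ hc
  obtain ⟨D, hD0, hD⟩ := S.exists_radius
  obtain ⟨a, ha0, ha⟩ := S.exists_le_area hP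
  have hcauchy : ∀ ε > 0, ∃ l K, ∀ k ≥ K, ∀ T, |S.pairDensity x f k T - l| ≤ ε := by
    intro ε hε
    obtain ⟨b, hb⟩ := exists_card_boundary_le hS hP hx (ρ := ρ + 2 * D)
      (ε := ε / (4 * (C + 1))) (by positivity)
    obtain ⟨l, hl⟩ := exists_tendsto_avg hS hP hsm (rotContinuous_pairDensity x hf b)
      (abs_pairDensity_le hS hP hC0 hC ha0 ha b)
    obtain ⟨K, hK⟩ := hl (ε / 2) (by positivity)
    refine ⟨l, K + b, fun k hk T => ?_⟩
    obtain ⟨j, rfl⟩ : ∃ j, k = j + b := ⟨k - b, by omega⟩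
    have h1 := hK j (by omega) T
    have hpos := scaledArea_pos hP (j + b) T.kind
    have h2 : |S.pairDensity x f (j + b) T - S.avg j (S.pairDensity x f b) T| ≤ ε / 2 := by
      have h3 := abs_pairSum_sub_sum_le hP hx hD hρ hfρ hC (S.nonOverlapping_superTile (j + b) T)
        (S.superTile j T) (S.superTile b)
        (S.pairwiseDisjoint_superTile hP (S.nonOverlapping_superTile j T) b)
        (fun U hU => by
          rw [superTile_add]
          exact Finset.subset_biUnion_of_mem (S.superTile b) hU)
      rw [← superTile_add, Finset.sdiff_self, Finset.card_empty, Nat.cast_zero, zero_add] at h3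
      have h4 : S.avg j (S.pairDensity x f b) T * (S.factor ^ (2 * (j + b)) * S.area T.kind) =
          ∑ U ∈ S.superTile j T, pairSum x f (S.superTile b U) := by
        have hA := (S.area_pos hP T.kind).ne'
        have hj := (S.factor_pow_pos (2 * j)).ne'
        rw [avg, mul_add, pow_add]
        field_simp
        rw [Finset.sum_mul]
        refine Finset.sum_congr rfl fun U _ => ?_
        rw [pairDensity_mul hP]
        ring
      have h5 : ∑ U ∈ S.superTile j T,
          ((S.boundary x (ρ + 2 * D) (S.superTile b U)).card : ℝ) ≤
            ε / (4 * (C + 1)) * (S.factor ^ (2 * (j + b)) * S.area T.kind) := by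
        refine (Finset.sum_le_sum fun U _ => hb b le_rfl U).trans_eq ?_
        rw [← Finset.mul_sum, ← Finset.mul_sum, S.sum_area_superTile hS hP, mul_add 2 j b, pow_add]
        ring
      refine le_of_mul_le_mul_right ?_ hpos
      rw [← abs_of_pos hpos, ← abs_mul, abs_of_pos hpos, sub_mul, ← pairDensity_mul hP, h4]
      refine h3.trans ?_
      have h6 : C * (2 * (ε / (4 * (C + 1)) * (S.factor ^ (2 * (j + b)) * S.area T.kind))) =
          C / (C + 1) * (ε / 2 * (S.factor ^ (2 * (j + b)) * S.area T.kind)) := by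
        field_simp; norm_num
      refine (mul_le_mul_of_nonneg_left (mul_le_mul_of_nonneg_left h5 two_pos.le) hC0).trans ?_
      rw [h6]
      refine mul_le_of_le_one_left (by positivity) ?_
      rw [div_le_one (by linarith)]
      linarith
    have := abs_add_le (S.pairDensity x f (j + b) T - S.avg j (S.pairDensity x f b) T)
      (S.avg j (S.pairDensity x f b) T - l)
    rw [sub_add_sub_cancel] at this
    linarith
  have T₀ : Tile m := ⟨0, 1, 0⟩
  have hseq : CauchySeq fun k => S.pairDensity x f k T₀ := by
    rw [Metric.cauchySeq_iff']
    intro ε hε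
    obtain ⟨l, K, hK⟩ := hcauchy (ε / 3) (by positivity)
    refine ⟨K, fun k hk => ?_⟩
    have h1 := abs_le.1 (hK k hk T₀)
    have h2 := abs_le.1 (hK K le_rfl T₀)
    rw [Real.dist_eq, abs_lt]
    constructor <;> linarith
  obtain ⟨l, hl⟩ := cauchySeq_tendsto_of_complete hseq
  refine ⟨l, fun ε hε => ?_⟩
  obtain ⟨l', K, hK⟩ := hcauchy (ε / 2) (by positivity)
  have h1 : |l - l'| ≤ ε / 2 :=
    le_of_tendsto (hl.sub_const l').abs (eventually_atTop.2 ⟨K, fun k hk => hK k hk T₀⟩)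
  refine ⟨K, fun k hk T => ?_⟩
  have h2 := abs_le.1 (hK k hk T)
  have h3 := abs_le.1 h1
  rw [abs_le]
  constructor <;> linarith

/-- Every finite part of the tiling lies in supertiles of arbitrarily high level. -/
theorem IsSupertileNumbering.exists_superTile {A : Set (Tile m)} {T : ℕ → Tile m}
    (h : S.IsSupertileNumbering A T) (K : ℕ) {F : Finset (Tile m)} (hF : (F : Set (Tile m)) ⊆ A) :
    ∃ n U, F ⊆ S.superTile (n + K) U ∧ (S.superTile (n + K) U : Set (Tile m)) ⊆ A := by
  obtain ⟨hinj, hrange, hnum⟩ := h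
  have hN : ∃ N, ∀ U ∈ F, ∃ j < N, T j = U := by
    have hj : ∀ U ∈ F, ∃ j, T j = U := fun U hU => by
      have := hF hU
      rw [← hrange] at this
      exact this
    choose! j hj using hj
    exact ⟨F.sup j + 1, fun U hU => ⟨j U, Nat.lt_succ_of_le (Finset.le_sup hU), hj U hU⟩⟩
  obtain ⟨N, hN⟩ := hN
  set b := ∑ k ∈ Finset.range K, ∑ i, (S.superTile k ⟨i, 1, 0⟩).card with hb
  obtain ⟨ℓ, hℓ, k, i, -, u, v, hcong⟩ := hnum (max N (b + 1))
  have hpow := (S.factor_pow_pos k).ne'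
  have hsup : (S.superTile k (Tile.move u (v / (S.factor ^ k : ℝ)) ⟨i, 1, 0⟩) : Set (Tile m)) =
      T '' {j | j < ℓ} := by
    rw [hcong, superTile_move, Finset.coe_image, coe_superTile_proto,
      mul_div_cancel₀ v (Complex.ofReal_ne_zero.2 hpow)]
  have hcard : ℓ = (S.superTile k ⟨i, 1, 0⟩).card := by
    have h1 : (T '' {j | j < ℓ}).ncard = ℓ := by
      rw [Set.ncard_image_of_injective _ hinj, show {j | j < ℓ} = (Finset.range ℓ : Set ℕ) by
        ext; simp, Set.ncard_coe_finset, Finset.card_range]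
    rw [hcong, Set.ncard_image_of_injective _ (Tile.move_injective u v), ← coe_superTile_proto,
      Set.ncard_coe_finset] at h1
    exact h1.symm
  have hk : K ≤ k := by
    by_contra! hlt
    have h1 : (S.superTile k ⟨i, 1, 0⟩).card ≤ b :=
      (Finset.single_le_sum (f := fun i => (S.superTile k ⟨i, 1, 0⟩).card)
        (fun _ _ => Nat.zero_le _) (Finset.mem_univ i)).trans
        (Finset.single_le_sum (f := fun k => ∑ i, (S.superTile k ⟨i, 1, 0⟩).card)
          (fun _ _ => Nat.zero_le _) (Finset.mem_range.2 hlt))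
    have := le_max_right N (b + 1)
    omega
  obtain ⟨n, rfl⟩ : ∃ n, k = n + K := ⟨k - K, by omega⟩
  refine ⟨n, _, fun U hU => ?_, hsup.trans_subset ?_⟩
  · rw [← Finset.mem_coe, hsup]
    obtain ⟨j, hj, rfl⟩ := hN U hU
    exact Set.mem_image_of_mem _ (show j < ℓ from hj.trans_le ((le_max_left _ _).trans hℓ))
  · rw [← hrange]
    exact Set.image_subset_range _ _

theorem finite_point_mem_closedBall (hS : S.IsPrimitive) (hP : ∀ i, (S.proto i).Nonempty)
    {x : Fin m → ℂ} (hx : ∀ i, x i ∈ S.proto i) {A : Set (Tile m)}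
    (hA : NonOverlapping S.proto A) (r : ℝ) : {T ∈ A | ‖T.point x‖ ≤ r}.Finite := by
  obtain ⟨D, hD0, hD⟩ := S.exists_radius
  obtain ⟨a, ha0, ha⟩ := S.exists_le_area hP
  by_contra hinf
  set v := volume.real (Metric.closedBall (0 : ℂ) (r + 2 * D))
  obtain ⟨N, hN⟩ := exists_nat_gt (v / a)
  obtain ⟨B, hB, hcard⟩ := Set.Infinite.exists_subset_card_eq hinf N
  have h := S.card_mul_le hS hP ha (hA.mono (hB.trans (Set.sep_subset _ _)))
    (measure_closedBall_lt_top (x := (0 : ℂ)) (r := r + 2 * D)).ne fun T hT z hz => by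
      have h1 := S.dist_le_of_mem_support hD hz (point_mem_support hx T)
      have h2 := (hB hT).2
      rw [← dist_zero_right] at h2
      rw [Metric.mem_closedBall]
      linarith [dist_triangle z (T.point x) 0]
  rw [hcard, ← le_div_iff₀ ha0] at h
  exact absurd hN (not_lt.2 h)

end Substitution

namespace Substitution

variable {S : Substitution m}

/-- The control points in large balls have the pair density of the supertiles. -/
theorem tendsto_pairSum_div (hS : S.IsPrimitive) {A : Set (Tile m)} (hA : S.IsTiling A)
    {T : ℕ → Tile m} (hT : S.IsSupertileNumbering A T) {x : Fin m → ℂ}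
    (hx : ∀ i, x i ∈ S.proto i) {f : ℂ → ℝ} (hf : Continuous f) (hf' : HasCompactSupport f) {l : ℝ}
    (hl : ∀ ε > 0, ∃ K, ∀ k ≥ K, ∀ T, |S.pairDensity x f k T - l| ≤ ε)
    {B : ℝ → Finset (Tile m)} (hB : ∀ r T, T ∈ B r ↔ T ∈ A ∧ ‖T.point x‖ ≤ r) :
    Tendsto (fun r => pairSum x f (B r) / (Real.pi * r ^ 2)) atTop (𝓝 l) := by
  have hP : ∀ i, (S.proto i).Nonempty := proto_nonempty hS hA
  obtain ⟨ρ, hρ, hfρ, c, hc⟩ := exists_bounds hf hf'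
  obtain ⟨C, hC0, hC⟩ := exists_abs_localSum_le hS hP hx hρ hfρ hc
  obtain ⟨D, hD0, hD⟩ := S.exists_radius
  obtain ⟨a, ha0, ha⟩ := S.exists_le_area hP
  rw [Metric.tendsto_atTop]
  suffices h : ∀ ε > 0, ∃ R, ∀ r ≥ R, |pairSum x f (B r) / (Real.pi * r ^ 2) - l| ≤ ε by
    intro ε hε
    obtain ⟨R, hR⟩ := h (ε / 2) (by positivity)
    exact ⟨R, fun r hr => by rw [Real.dist_eq]; linarith [hR r hr]⟩
  intro ε hε
  obtain ⟨K₁, hK₁⟩ := exists_card_boundary_le hS hP hx (ρ := ρ + 2 * D)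
    (ε := ε / (32 * (C + 1))) (by positivity)
  obtain ⟨K₂, hK₂⟩ := hl (ε / 16) (by positivity)
  set K := max K₁ K₂
  set α := 2 * D * S.factor ^ K + 2 * D with hα
  have hα0 : 0 < α := by have := S.factor_pow_pos K; positivity
  have hα1 : 2 * D ≤ α := by have := S.factor_pow_pos K; rw [hα]; nlinarith
  refine ⟨max α (8 * (C / a + |l|) * α / ε), fun r hr => ?_⟩
  have hrα : α ≤ r := (le_max_left _ _).trans hr
  have hr0 : 0 < r := hα0.trans_le hrα
  have hrε : 8 * (C / a + |l|) * α ≤ r * ε := (div_le_iff₀ hε).1 ((le_max_right _ _).trans hr)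
  have hBA : (B r : Set (Tile m)) ⊆ A := fun T hT => ((hB r T).1 hT).1
  have hBno : NonOverlapping S.proto (B r : Set (Tile m)) := hA.2.mono hBA
  obtain ⟨n, T₀, hBT₀, hT₀A⟩ := hT.exists_superTile K hBA
  classical
  set I := (S.superTile n T₀).filter fun T => S.superTile K T ⊆ B r with hI
  have hdisj : (I : Set (Tile m)).PairwiseDisjoint (S.superTile K) :=
    S.pairwiseDisjoint_superTile hP ((S.nonOverlapping_superTile n T₀).mono
      (Finset.coe_subset.2 (Finset.filter_subset _ _))) K
  have hsubB : ∀ T ∈ I, S.superTile K T ⊆ B r := fun T hT => (Finset.mem_filter.1 hT).2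
  -- a tile of the tiling whose control point is well inside the ball belongs to a good supertile
  have hgood : ∀ U ∈ A, ‖U.point x‖ ≤ r - 2 * D * S.factor ^ K → U ∈ I.biUnion (S.superTile K) := by
    intro U hU hUr
    have hUB : U ∈ B r := (hB r U).2 ⟨hU, by have := S.factor_pow_pos K; nlinarith⟩
    have hU' := hBT₀ hUB
    rw [superTile_add, Finset.mem_biUnion] at hU'
    obtain ⟨V, hV, hUV⟩ := hU'
    refine Finset.mem_biUnion.2 ⟨V, Finset.mem_filter.2 ⟨hV, fun W hW => ?_⟩, hUV⟩
    have hWA : W ∈ A := hT₀A (by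
      rw [superTile_add, Finset.mem_coe, Finset.mem_biUnion]; exact ⟨V, hV, hW⟩)
    refine (hB r W).2 ⟨hWA, ?_⟩
    have h1 := S.dist_le_of_mem_smul_support hD
      (S.support_subset_of_mem_superTile hW (point_mem_support hx W))
      (S.support_subset_of_mem_superTile hUV (point_mem_support hx U))
    rw [dist_eq_norm] at h1
    linarith [norm_le_norm_add_norm_sub' (W.point x) (U.point x)]
  set V := ∑ T ∈ I, S.factor ^ (2 * K) * S.area T.kind with hVdef
  have hV : V = ∑ U ∈ I.biUnion (S.superTile K), S.area U.kind := by
    rw [Finset.sum_biUnion hdisj]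
    exact Finset.sum_congr rfl fun T _ => (S.sum_area_superTile hS hP K T).symm
  have hsuppB : ∀ U ∈ B r, U.support S.proto ⊆ Metric.closedBall 0 (r + α) := by
    intro U hU z hz
    have h1 := S.dist_le_of_mem_support hD hz (point_mem_support hx U)
    have h2 := ((hB r U).1 hU).2
    rw [← dist_zero_right] at h2
    rw [Metric.mem_closedBall]
    linarith [dist_triangle z (U.point x) 0]
  have hVle : V ≤ Real.pi * (r + α) ^ 2 := by
    rw [hV, ← volume_real_closedBall 0 (by positivity)]
    have hsub : I.biUnion (S.superTile K) ⊆ B r := Finset.biUnion_subset.2 hsubB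
    exact S.sum_area_le hS hP (hBno.mono (Finset.coe_subset.2 hsub)) measure_closedBall_lt_top.ne
      fun U hU => hsuppB U (hsub hU)
  have hVge : Real.pi * (r - α) ^ 2 ≤ V := by
    rw [hV, ← volume_real_closedBall 0 (sub_nonneg.2 hrα)]
    refine S.volume_real_le_sum_area fun z hz => ?_
    have hzA : z ∈ ⋃ T ∈ A, T.support S.proto := by rw [hA.1]; trivial
    simp only [Set.mem_iUnion] at hzA
    obtain ⟨U, hU, hzU⟩ := hzA
    refine Set.mem_biUnion (hgood U hU ?_) hzU
    have h1 := S.dist_le_of_mem_support hD (point_mem_support hx U) hzU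
    rw [Metric.mem_closedBall] at hz
    rw [← dist_zero_right]
    linarith [dist_triangle (U.point x) z 0]
  have hrest : ((B r \ I.biUnion (S.superTile K)).card : ℝ) * a ≤ Real.pi * (4 * α * r) := by
    have hvol : volume.real (Metric.closedBall (0 : ℂ) (r + α) \ Metric.closedBall 0 (r - α)) =
        Real.pi * (4 * α * r) := by
      rw [measureReal_sdiff (Metric.closedBall_subset_closedBall (by linarith))
        Metric.isClosed_closedBall.measurableSet measure_closedBall_lt_top.ne,
        volume_real_closedBall 0 (by positivity), volume_real_closedBall 0 (sub_nonneg.2 hrα)]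
      ring
    rw [← hvol]
    refine S.card_mul_le hS hP ha (hBno.mono (Finset.coe_subset.2 Finset.sdiff_subset))
      ((measure_mono Set.sdiff_subset).trans_lt measure_closedBall_lt_top).ne fun U hU z hz => ?_
    rw [Finset.mem_sdiff] at hU
    refine ⟨hsuppB U hU.1 hz, fun hz' => hU.2 (hgood U (hBA hU.1) ?_)⟩
    have h1 := S.dist_le_of_mem_support hD (point_mem_support hx U) hz
    rw [Metric.mem_closedBall] at hz'
    rw [← dist_zero_right]
    linarith [dist_triangle (U.point x) z 0]
  have hbdry : ∑ T ∈ I, ((S.boundary x (ρ + 2 * D) (S.superTile K T)).card : ℝ) ≤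
      ε / (32 * (C + 1)) * V := by
    rw [hVdef, Finset.mul_sum]
    exact Finset.sum_le_sum fun T _ => hK₁ K (le_max_left _ _) T
  have hmain : |∑ T ∈ I, pairSum x f (S.superTile K T) - l * V| ≤ ε / 16 * V := by
    rw [hVdef, Finset.mul_sum, Finset.mul_sum, ← Finset.sum_sub_distrib]
    refine (Finset.abs_sum_le_sum_abs _ _).trans (Finset.sum_le_sum fun T _ => ?_)
    rw [pairDensity_mul hP, ← sub_mul, abs_mul, abs_of_pos (scaledArea_pos hP K T.kind)]
    exact mul_le_mul_of_nonneg_right (hK₂ K (le_max_right _ _) T) (scaledArea_pos hP K T.kind).le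
  have hadd := abs_pairSum_sub_sum_le hP hx hD hρ hfρ hC hBno I (S.superTile K) hdisj hsubB
  have hpi := Real.pi_pos
  have hVr : |V - Real.pi * r ^ 2| ≤ Real.pi * (4 * α * r) := by
    have h1 : Real.pi * (r + α) ^ 2 - Real.pi * r ^ 2 ≤ Real.pi * (4 * α * r) := by
      rw [← mul_sub]
      exact mul_le_mul_of_nonneg_left (by nlinarith) hpi.le
    have h2 : Real.pi * r ^ 2 - Real.pi * (r - α) ^ 2 ≤ Real.pi * (4 * α * r) := by
      rw [← mul_sub]
      exact mul_le_mul_of_nonneg_left (by nlinarith) hpi.le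
    rw [abs_le]
    constructor <;> linarith
  have hV4 : V ≤ 4 * (Real.pi * r ^ 2) := by
    refine hVle.trans ?_
    have : (r + α) ^ 2 ≤ 4 * r ^ 2 := by nlinarith
    have := mul_le_mul_of_nonneg_left this hpi.le
    linarith
  have hX : 0 < Real.pi * r ^ 2 := by positivity
  have e1 : C * (B r \ I.biUnion (S.superTile K)).card ≤ C / a * (Real.pi * (4 * α * r)) := by
    rw [div_mul_eq_mul_div, le_div_iff₀ ha0, mul_assoc]
    exact mul_le_mul_of_nonneg_left hrest hC0
  have e2 : C * (2 * ∑ T ∈ I, ((S.boundary x (ρ + 2 * D) (S.superTile K T)).card : ℝ)) ≤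
      ε / 4 * (Real.pi * r ^ 2) := by
    have h1 : C * (2 * ∑ T ∈ I, ((S.boundary x (ρ + 2 * D) (S.superTile K T)).card : ℝ)) ≤
        C * (2 * (ε / (32 * (C + 1)) * (4 * (Real.pi * r ^ 2)))) := by
      refine mul_le_mul_of_nonneg_left (mul_le_mul_of_nonneg_left (hbdry.trans ?_) two_pos.le) hC0
      exact mul_le_mul_of_nonneg_left hV4 (by positivity)
    refine h1.trans ?_
    have h2 : C * (2 * (ε / (32 * (C + 1)) * (4 * (Real.pi * r ^ 2)))) =
        C / (C + 1) * (ε / 4 * (Real.pi * r ^ 2)) := by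
      field_simp; ring
    rw [h2]
    refine mul_le_of_le_one_left (by positivity) ?_
    rw [div_le_one (by linarith)]
    linarith
  have e3 : ε / 16 * V ≤ ε / 4 * (Real.pi * r ^ 2) := by
    have := mul_le_mul_of_nonneg_left hV4 (show 0 ≤ ε / 16 by positivity)
    linarith
  have e4 : |l * V - l * (Real.pi * r ^ 2)| ≤ |l| * (Real.pi * (4 * α * r)) := by
    rw [← mul_sub, abs_mul]
    exact mul_le_mul_of_nonneg_left hVr (abs_nonneg l)
  have e5 : (C / a + |l|) * (Real.pi * (4 * α * r)) ≤ ε / 2 * (Real.pi * r ^ 2) := by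
    have := mul_le_mul_of_nonneg_left hrε (show 0 ≤ Real.pi * r / 2 by positivity)
    linarith
  rw [div_sub' hX.ne', abs_div, abs_of_pos hX, div_le_iff₀ hX, mul_comm _ l]
  have t1 := abs_add_le (pairSum x f (B r) - ∑ T ∈ I, pairSum x f (S.superTile K T))
    (∑ T ∈ I, pairSum x f (S.superTile K T) - l * V)
  have t2 := abs_add_le (pairSum x f (B r) - ∑ T ∈ I, pairSum x f (S.superTile K T) +
    (∑ T ∈ I, pairSum x f (S.superTile K T) - l * V)) (l * V - l * (Real.pi * r ^ 2))
  rw [sub_add_sub_cancel, sub_add_sub_cancel] at t2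
  rw [sub_add_sub_cancel] at t1
  linarith

end Substitution

theorem integral_autocorrelationApprox {Λ : Set ℂ} {r : ℝ} {s : Finset ℂ}
    (hs : (s : Set ℂ) = Λ ∩ Metric.closedBall 0 r) (hr : 0 ≤ r) (f : ℂ → ℝ) :
    ∫ z, f z ∂(autocorrelationApprox Λ r) =
      (∑ a ∈ s, ∑ b ∈ s, f (a - b)) / (Real.pi * r ^ 2) := by
  rw [autocorrelationApprox, ← hs, integral_smul_measure, ENNReal.toReal_inv, ← measureReal_def,
    volume_real_closedBall 0 hr, smul_eq_mul, div_eq_inv_mul]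
  congr 1
  have : Fintype ((s : Set ℂ) ×ˢ (s : Set ℂ) : Set (ℂ × ℂ)) :=
    ((s.finite_toSet).prod s.finite_toSet).fintype
  rw [Measure.sum_fintype, integral_finsetSum_measure fun p _ => integrable_dirac (by simp)]
  simp only [integral_dirac]
  rw [← Finset.sum_product']
  exact (Finset.sum_subtype (s ×ˢ s) (p := (· ∈ (s : Set ℂ) ×ˢ (s : Set ℂ))) (by simp)
    fun p : ℂ × ℂ => f (p.1 - p.2)).symm

theorem isFiniteMeasure_autocorrelationApprox {Λ : Set ℂ} {r : ℝ}
    (hΛ : (Λ ∩ Metric.closedBall 0 r).Finite) (hr : 0 < r) :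
    IsFiniteMeasure (autocorrelationApprox Λ r) := by
  have := (hΛ.prod hΛ).fintype
  rw [autocorrelationApprox, Measure.sum_fintype]
  refine Measure.smul_finite _ (ENNReal.inv_ne_top.2 ?_)
  exact (Metric.measure_closedBall_pos volume (0 : ℂ) hr).ne'

theorem controlPoints_inter_closedBall (x : Fin m → ℂ) (A : Set (Tile m)) (r : ℝ) :
    controlPoints x A ∩ Metric.closedBall 0 r = Tile.point x '' {T ∈ A | ‖T.point x‖ ≤ r} := by
  ext z
  simp only [controlPoints, Set.mem_inter_iff, Set.mem_image, mem_closedBall_zero_iff,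
    Set.mem_ofPred_eq]
  constructor
  · rintro ⟨⟨U, hU, rfl⟩, hr⟩
    exact ⟨U, ⟨hU, hr⟩, rfl⟩
  · rintro ⟨U, ⟨hU, hr⟩, rfl⟩
    exact ⟨⟨U, hU, rfl⟩, hr⟩

/-- Convergence of the autocorrelation approximations against test functions, with rotation
invariant limits. -/
theorem exists_tendsto_integral_autocorrelationApprox {S : Substitution m} (hS : S.IsPrimitive)
    {A : Set (Tile m)} (hA : S.IsTiling A) (hsym : S.HasStatisticalCircularSymmetry A)
    {x : Fin m → ℂ} (hx : ∀ i, x i ∈ S.proto i) {f : ℂ → ℝ} (hf : Continuous f)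
    (hf' : HasCompactSupport f) :
    ∃ l : ℝ, ∀ u : Circle, Tendsto
      (fun r => ∫ z, f (u * z) ∂(autocorrelationApprox (controlPoints x A) r)) atTop (𝓝 l) := by
  have hP : ∀ i, (S.proto i).Nonempty := Substitution.proto_nonempty hS hA
  have hm : NeZero m := by
    refine ⟨fun h => ?_⟩
    subst h
    have h0 : (0 : ℂ) ∈ ⋃ T ∈ A, T.support S.proto := by rw [hA.1]; trivial
    simp only [Set.mem_iUnion] at h0
    obtain ⟨T, -⟩ := h0
    exact T.kind.elim0
  obtain ⟨l, hl⟩ := Substitution.exists_tendsto_pairDensity hS hP hsym.hasSmallAngles hx hf hf'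
  obtain ⟨T, hT, -⟩ := hsym
  refine ⟨l, fun u => ?_⟩
  have hfin := Substitution.finite_point_mem_closedBall hS hP hx hA.2
  set B : ℝ → Finset (Tile m) := fun r => (hfin r).toFinset with hBdef
  have hB : ∀ r T, T ∈ B r ↔ T ∈ A ∧ ‖T.point x‖ ≤ r := fun r T => by simp [hBdef]
  have hfu : Continuous fun z : ℂ => f (u * z) := hf.comp (continuous_const.mul continuous_id)
  have hfu' : HasCompactSupport fun z : ℂ => f (u * z) :=
    hf'.comp_homeomorph (rotation u).toHomeomorph
  have hlim := Substitution.tendsto_pairSum_div hS hA hT hx hfu hfu' (l := l) (fun ε hε => by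
    obtain ⟨K, hK⟩ := hl ε hε
    refine ⟨K, fun k hk U => ?_⟩
    rw [← Substitution.pairDensity_move x f k u 0]
    exact hK k hk _) hB
  refine hlim.congr' ?_
  filter_upwards [eventually_ge_atTop 0] with r hr
  rw [integral_autocorrelationApprox (s := (B r).image (Tile.point x)) _ hr]
  · rfl
  · rw [controlPoints_inter_closedBall, Finset.coe_image, Set.Finite.coe_toFinset]

open scoped CompactlySupported in
/-- A family of measures converges vaguely if the integrals of all test functions converge. -/
theorem exists_vagueTendsto {ι : Type*} {μ : ι → Measure ℂ} {l : Filter ι} [l.NeBot]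
    (hμ : ∀ᶠ i in l, IsFiniteMeasureOnCompacts (μ i))
    (h : ∀ f : ℂ → ℝ, Continuous f → HasCompactSupport f →
      ∃ c, Tendsto (fun i => ∫ z, f z ∂(μ i)) l (𝓝 c)) :
    ∃ γ : Measure ℂ, VagueTendsto μ l γ := by
  have h' : ∀ f : C_c(ℂ, ℝ), ∃ c, Tendsto (fun i => ∫ z, f z ∂(μ i)) l (𝓝 c) := fun f =>
    h f f.continuous f.hasCompactSupport
  choose L hL using h'
  have hint : ∀ᶠ i in l, ∀ f : C_c(ℂ, ℝ), Integrable f (μ i) := by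
    filter_upwards [hμ] with i hi f
    exact f.continuous.integrable_of_hasCompactSupport f.hasCompactSupport
  have hadd : ∀ f g, L (f + g) = L f + L g := fun f g => by
    refine tendsto_nhds_unique (hL (f + g)) (((hL f).add (hL g)).congr' ?_)
    filter_upwards [hint] with i hi
    exact (integral_add (hi f) (hi g)).symm
  have hsmul : ∀ (c : ℝ) f, L (c • f) = c • L f := fun c f => by
    refine tendsto_nhds_unique (hL (c • f)) (((hL f).const_smul c).congr fun i => ?_)
    exact (integral_smul c f).symm
  have hpos : ∀ f : C_c(ℂ, ℝ), 0 ≤ f → 0 ≤ L f := fun f hf =>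
    ge_of_tendsto' (hL f) fun i => integral_nonneg fun z => hf z
  let Λ : C_c(ℂ, ℝ) →ₚ[ℝ] ℝ := PositiveLinearMap.mk₀ ⟨⟨L, hadd⟩, hsmul⟩ hpos
  refine ⟨RealRMK.rieszMeasure Λ, inferInstance, fun f hf hf' => ?_⟩
  have h1 := RealRMK.integral_rieszMeasure Λ ⟨⟨f, hf⟩, hf'⟩
  have h2 := hL ⟨⟨f, hf⟩, hf'⟩
  rw [show L ⟨⟨f, hf⟩, hf'⟩ = Λ ⟨⟨f, hf⟩, hf'⟩ from rfl, ← h1] at h2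
  exact h2

open scoped CompactlySupported in
theorem isCircularSymmetric_of_integral_eq {γ : Measure ℂ} [IsLocallyFiniteMeasure γ]
    (h : ∀ f : ℂ → ℝ, Continuous f → HasCompactSupport f →
      ∀ u : Circle, ∫ z, f (u * z) ∂γ = ∫ z, f z ∂γ) : IsCircularSymmetric γ := by
  intro u
  have : (γ.map (rotation u)).Regular := Measure.Regular.map (rotation u).toHomeomorph
  refine Measure.ext_of_integral_eq_on_compactlySupported fun f => ?_
  refine (integral_map (rotation u).continuous.aemeasurable
    f.continuous.aestronglyMeasurable).trans ?_
  exact h f f.continuous f.hasCompactSupport u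

end SubstTiling

theorem mainTheorem3 {m : ℕ} (S : SubstTiling.Substitution m) (hS : S.IsPrimitive)
    (A : Set (SubstTiling.Tile m)) (hA : S.IsSubstitutionTiling A)
    (hsym : S.HasStatisticalCircularSymmetry A)
    (x : Fin m → ℂ) (hx : ∀ i, x i ∈ S.proto i) :
    (∃ γ : MeasureTheory.Measure ℂ,
      SubstTiling.IsAutocorrelation (SubstTiling.controlPoints x A) γ) ∧
    ∀ γ : MeasureTheory.Measure ℂ,
      SubstTiling.IsSubsequentialAutocorrelation (SubstTiling.controlPoints x A) γ →
        SubstTiling.IsCircularSymmetric γ := by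
  have key : ∀ f : ℂ → ℝ, Continuous f → HasCompactSupport f → _ := fun f hf hf' =>
    SubstTiling.exists_tendsto_integral_autocorrelationApprox hS hA.1 hsym hx hf hf'
  constructor
  · refine SubstTiling.exists_vagueTendsto ?_ fun f hf hf' => ?_
    · filter_upwards [eventually_gt_atTop 0] with r hr
      have hfin : (SubstTiling.controlPoints x A ∩ Metric.closedBall 0 r).Finite := by
        rw [SubstTiling.controlPoints_inter_closedBall]
        exact (SubstTiling.Substitution.finite_point_mem_closedBall hS
          (SubstTiling.Substitution.proto_nonempty hS hA.1) hx hA.1.2 r).image _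
      have := SubstTiling.isFiniteMeasure_autocorrelationApprox hfin hr
      infer_instance
    · obtain ⟨l, hl⟩ := key f hf hf'
      exact ⟨l, by simpa using hl 1⟩
  · rintro γ ⟨r, hr, hγ, hlim⟩
    refine SubstTiling.isCircularSymmetric_of_integral_eq fun f hf hf' u => ?_
    obtain ⟨l, hl⟩ := key f hf hf'
    have h1 := hlim f hf hf'
    have h2 := hlim (fun z => f (u * z)) (hf.comp (continuous_const.mul continuous_id))
      (hf'.comp_homeomorph (rotation u).toHomeomorph)
    have h3 : Tendsto (fun n => ∫ z, f z ∂(SubstTiling.autocorrelationApprox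
        (SubstTiling.controlPoints x A) (r n))) atTop (𝓝 l) := by
      simpa [Function.comp_def] using (hl 1).comp hr
    rw [tendsto_nhds_unique h1 h3, tendsto_nhds_unique h2 ((hl u).comp hr)]

end
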